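/- Let $d\ge 1$ and let $G$ be the Coulomb kernel on $\mathbb R^d$, i.e. $G(x,y)=\frac{1}{(d-2)\|x-y\|^{d-2}}$ if $d\neq 2$ and $G(x,y)=-\log\|x-y\|$ if $d=2$ (with value $+\infty$ for $x=y$ when $d\ge 2$). A probability measure $\rho$ on $\mathbb R^d$ has finite Coulomb energy if $\iint |G|\,d\rho\,d\rho<\infty$. Fix a probability measure $\nu$ of finite Coulomb energy and, for a probability measure $\rho$, put $$E_\nu(\rho)=\tfrac12\iint G(x,y)\,d(\rho-\nu)(x)\,d(\rho-\nu)(y)$$ if $\rho$ has finite Coulomb energy, and $E_\nu(\rho)=+\infty$ otherwise. Let $W_2^2(\mu,\rho)\in[0,\infty]$ be the infimum of $\int\|x-y\|^2\,d\gamma(x,y)$ over all couplings $\gamma$ of $\mu$ and $\rho$. A probability measure $\mu$ is called a Wasserstein critical point of $E_\nu$ if $E_\nu(\mu)<+\infty$ and there is $\tau_0>0$ such that for all $0<\tau\le\tau_0$ $$\mu\in\operatorname*{arg\,min}_{\rho\in\mathcal P(\mathbb R^d)}\ E_\nu(\rho)+\frac1{2\tau}W_2^2(\mu,\rho).$$ Let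 $\mu$ be a probability measure on $\mathbb R^d$ and let $\mu-\nu=\mu_+-\nu_-$ be the Hahn–Jordan decomposition of $\mu-\nu$ into mutually singular positive measures. (1) Suppose there are a Borel set $A\subset\mathbb R^d$ with $\mu_+(A)>0$ and numbers $0<\delta<2$, $C>0$, $r_0>0$ such that for all $0<r\le r_0$ and $\mu_+$-almost every $x\in A$, $$\mu_+(B(x,r))\ge C\,r^{d-\delta}.$$ Then $\mu$ is not a Wasserstein critical point of $E_\nu$. (2) Suppose there are a Borel set $A\subset\mathbb R^d$ with $\mu_+(A)>0$ and a number $0<\delta\le 1$ such that $\mu_{+|A}$ has local Minkowski dimension less than $d-\delta$, i.e. for $\mu_+$-almost every $x\in A$ the limit $$\lim_{r\to0^+}\frac{\log\big(\mu_{+|A}(B(x,r))\big)}{\log r}$$ exists and is $<d-\delta$. Then $\mu$ is not a Wasserstein critical point of $E_\nu$. -/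

import Mathlib

open MeasureTheory Filter Topology
open scoped ENNReal

noncomputable section

/-- The Riesz kernel `1 / (s ‖x - y‖ ^ s)` for `s ≠ 0`, and `-log ‖x - y‖` for `s = 0`, with values
in the extended reals. On the diagonal it is `+∞` for `s ≥ 0` and `0` for `s < 0`. -/
def rieszKernel {X : Type*} [EDist X] (s : ℝ) (x y : X) : EReal :=
  if s = 0 then -ENNReal.log (edist x y)
  else ((edist x y ^ (-s) : ℝ≥0∞) : EReal) / (s : EReal)

/-- The Coulomb kernel of `ℝ^d`, i.e. the Riesz kernel of exponent `s = d - 2`. -/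
def coulombKernel (d : ℕ) (x y : EuclideanSpace ℝ (Fin d)) : EReal :=
  rieszKernel ((d : ℝ) - 2) x y

section Energy

variable {X : Type*} [MeasurableSpace X]

/-- `∬ G⁺ dα dβ`. -/
def energyPos (G : X → X → EReal) (α β : Measure X) : ℝ≥0∞ :=
  ∫⁻ x, ∫⁻ y, (G x y).toENNReal ∂β ∂α

/-- `∬ G⁻ dα dβ`. -/
def energyNeg (G : X → X → EReal) (α β : Measure X) : ℝ≥0∞ :=
  ∫⁻ x, ∫⁻ y, (-(G x y)).toENNReal ∂β ∂α

/-- The mutual energy `⟨α, G ⋆ β⟩ = ∬ G dα dβ`. -/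
def mutualEnergy (G : X → X → EReal) (α β : Measure X) : EReal :=
  (energyPos G α β : EReal) - (energyNeg G α β : EReal)

/-- The measure `α` has finite internal `G`-energy: `∬ |G| dα dα < ∞`. -/
def HasFiniteEnergy (G : X → X → EReal) (α : Measure X) : Prop :=
  energyPos G α α < ⊤ ∧ energyNeg G α α < ⊤

open Classical in
/-- The functional `E_ν(ρ) = E(ρ - ν) = (1/2) ⟨ρ - ν, G ⋆ (ρ - ν)⟩`, expanded by bilinearity and
symmetry of `G`, for `ρ` of finite internal energy, and `+∞` for the other `ρ`. -/
def mmdEnergy (G : X → X → EReal) (ν ρ : ProbabilityMeasure X) : EReal :=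
  if HasFiniteEnergy G (ρ : Measure X) then
    mutualEnergy G (ρ : Measure X) (ρ : Measure X) / 2
      - mutualEnergy G (ρ : Measure X) (ν : Measure X)
      + mutualEnergy G (ν : Measure X) (ν : Measure X) / 2
  else ⊤

end Energy

/-- The squared Wasserstein distance `W₂²(μ, ρ)`: the infimum over the transport plans of
`∬ d(x, y)² dγ`, with values in `[0, ∞]`. -/
def sqWasserstein {X : Type*} [MeasurableSpace X] [EDist X] (μ ρ : Measure X) : ℝ≥0∞ :=
  ⨅ γ ∈ {γ : Measure (X × X) | γ.map Prod.fst = μ ∧ γ.map Prod.snd = ρ},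
    ∫⁻ p, edist p.1 p.2 ^ 2 ∂γ

/-- `μ` is a Wasserstein critical point of `F`: `F μ < ∞`, and for some `τ₀ > 0` and every
`0 < τ ≤ τ₀`, `μ` minimizes `ρ ↦ F ρ + W₂²(μ, ρ) / (2 τ)` among all probability measures. -/
def IsWassersteinCriticalPoint {X : Type*} [MeasurableSpace X] [EDist X]
    (F : ProbabilityMeasure X → EReal) (μ : ProbabilityMeasure X) : Prop :=
  F μ < ⊤ ∧ ∃ τ₀ : ℝ, 0 < τ₀ ∧ ∀ τ : ℝ, 0 < τ → τ ≤ τ₀ →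
    IsMinOn
      (fun ρ : ProbabilityMeasure X =>
        F ρ + ((sqWasserstein (μ : Measure X) (ρ : Measure X) / ENNReal.ofReal (2 * τ) : ℝ≥0∞) :
          EReal))
      Set.univ μ

/-- The positive part `μ₊` in the Hahn-Jordan decomposition `μ - ν = μ₊ - ν₋`. -/
def diffPosPart {X : Type*} [MeasurableSpace X] (μ ν : ProbabilityMeasure X) : Measure X :=
  ((μ : Measure X).toSignedMeasure - (ν : Measure X).toSignedMeasure).toJordanDecomposition.posPart

/-- The local (Minkowski) dimension of `m` at `x` exists and equals `l`:
`log (m (B(x, r))) / log r → l` as `r → 0⁺` (where `log 0 = -∞`). -/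
def HasLocalDimension {X : Type*} [MeasurableSpace X] [PseudoMetricSpace X]
    (m : Measure X) (x : X) (l : ℝ) : Prop :=
  Tendsto (fun r : ℝ => ENNReal.log (m (Metric.ball x r)) / (Real.log r : EReal))
    (𝓝[>] 0) (𝓝 (l : EReal))

end

/-! Test criticality by diffusing a little mass of `μ` out of the region where `μ₊` has infinite
density. With `p_t(x) = t ^ (-d/2) exp (-‖x‖² / t)`, the Coulomb kernel is, up to an additive
constant, `c (∫₀¹ p_t dt - ∫₁^∞ (p_t(0) - p_t(x)) dt)` with `c = 1 / (2 Γ(d/2))`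
(`exists_coulombKernel_decomposition`). Subtracting `p_t(0)` for `t > 1` makes the time integral
converge in dimensions 1 and 2 as well. Convolution with the law of `√s z`, `z` Gaussian, sends
`p_t` to `p_{t+s}`, so it changes the kernel by exactly `-c ∫₀ˢ p_t dt` plus a constant, and the
constant cancels when tested against `μ - ν`, which has mass zero.

Let `α ≤ μ`, and replace a fraction `ε` of `α` by its Gaussian average. The energy changes by `-ε c
∫₀ˢ ⟨α, p_t ⋆ (μ - ν)⟩ dt + O(ε²)`, while the transport term is at most `ε s M α(univ) / (2τ)`, with
`M` the second moment of `z`. Minimality and `ε → 0` give `c ∫₀ˢ ⟨α, p_t ⋆ (μ - ν)⟩ dt ≤ s M α(univ)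
/ (2τ)` (`IsCoulombShift.first_variation`).

Either growth hypothesis makes `μ₊(B(x, r)) / r ^ d` tend to infinity for `μ₊`-almost every `x` in
`A`. Since `ν₋` is singular to `μ₊`, Besicovitch differentiation makes it negligible on small balls
around such points (`exists_set_closedBall_le`). A layer cake over balls then bounds `p_t ⋆ (μ - ν)`
below by an arbitrarily large constant on a set `T` charged by `μ₊`, for all small `t`
(`lintegral_heatKernel_add_le_of_ball`). Taking `α = μ₊` restricted to `T` contradicts the first
variation inequality.

Infinite values are handled by writing kernel identities additively in `ℝ≥0∞`, with real subtraction
only after finiteness is known. -/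

noncomputable section

/-! ### Heat kernel, its time integrals, and their Gaussian averages -/

section HeatKernel

variable {d : ℕ}

/-- The unnormalised heat kernel `t ^ (-d/2) exp (-‖x‖² / t)`. -/
def heatKernel (t : ℝ) (x : EuclideanSpace ℝ (Fin d)) : ℝ≥0∞ :=
  ENNReal.ofReal (t ^ (-(d : ℝ) / 2) * Real.exp (-‖x‖ ^ 2 / t))

/-- The difference `heatKernel t 0 - heatKernel t x`. -/
def heatDeficit (t : ℝ) (x : EuclideanSpace ℝ (Fin d)) : ℝ≥0∞ :=
  ENNReal.ofReal (t ^ (-(d : ℝ) / 2) * (1 - Real.exp (-‖x‖ ^ 2 / t)))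

/-- The heat kernel integrated over a set of times. -/
def heatInt (I : Set ℝ) (x : EuclideanSpace ℝ (Fin d)) : ℝ≥0∞ := ∫⁻ t in I, heatKernel t x

/-- The heat deficit integrated over the times `t > 1`. -/
def deficitInt (x : EuclideanSpace ℝ (Fin d)) : ℝ≥0∞ := ∫⁻ t in Set.Ioi (1 : ℝ), heatDeficit t x

/-- The centred Gaussian probability measure of density `π ^ (-d/2) exp (-‖z‖²)`. -/
def gaussMeasure (d : ℕ) : Measure (EuclideanSpace ℝ (Fin d)) :=
  volume.withDensity fun z => ENNReal.ofReal (Real.pi ^ (-(d : ℝ) / 2) * Real.exp (-‖z‖ ^ 2))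

@[fun_prop]
theorem measurable_heatKernel :
    Measurable fun p : ℝ × EuclideanSpace ℝ (Fin d) => heatKernel p.1 p.2 := by
  unfold heatKernel; fun_prop

@[fun_prop]
theorem measurable_heatDeficit :
    Measurable fun p : ℝ × EuclideanSpace ℝ (Fin d) => heatDeficit p.1 p.2 := by
  unfold heatDeficit; fun_prop

@[fun_prop]
theorem measurable_heatKernel_left (x : EuclideanSpace ℝ (Fin d)) :
    Measurable fun t => heatKernel t x :=
  measurable_heatKernel.comp (by fun_prop : Measurable fun t : ℝ => (t, x))

@[fun_prop]
theorem measurable_heatKernel_right (t : ℝ) :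
    Measurable fun x : EuclideanSpace ℝ (Fin d) => heatKernel t x :=
  measurable_heatKernel.comp (by fun_prop : Measurable fun x => (t, x))

@[fun_prop]
theorem measurable_heatDeficit_left (x : EuclideanSpace ℝ (Fin d)) :
    Measurable fun t => heatDeficit t x :=
  measurable_heatDeficit.comp (by fun_prop : Measurable fun t : ℝ => (t, x))

@[fun_prop]
theorem measurable_heatDeficit_right (t : ℝ) :
    Measurable fun x : EuclideanSpace ℝ (Fin d) => heatDeficit t x :=
  measurable_heatDeficit.comp (by fun_prop : Measurable fun x => (t, x))

@[fun_prop]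
theorem measurable_heatInt (I : Set ℝ) :
    Measurable (heatInt I : EuclideanSpace ℝ (Fin d) → ℝ≥0∞) :=
  (measurable_heatKernel.comp measurable_swap).lintegral_prod_right'

@[fun_prop]
theorem measurable_deficitInt :
    Measurable (deficitInt : EuclideanSpace ℝ (Fin d) → ℝ≥0∞) :=
  (measurable_heatDeficit.comp measurable_swap).lintegral_prod_right'

theorem heatKernel_neg (t : ℝ) (x : EuclideanSpace ℝ (Fin d)) :
    heatKernel t (-x) = heatKernel t x := by simp [heatKernel]

theorem heatInt_neg (I : Set ℝ) (x : EuclideanSpace ℝ (Fin d)) :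
    heatInt I (-x) = heatInt I x := by simp [heatInt, heatKernel_neg]

theorem deficitInt_neg (x : EuclideanSpace ℝ (Fin d)) :
    deficitInt (-x) = deficitInt x := by simp [deficitInt, heatDeficit]

theorem lintegral_exp_neg_mul_sq_norm {b : ℝ} (hb : 0 < b) :
    ∫⁻ z : EuclideanSpace ℝ (Fin d), ENNReal.ofReal (Real.exp (-b * ‖z‖ ^ 2)) =
      ENNReal.ofReal ((Real.pi / b) ^ ((d : ℝ) / 2)) := by
  have h := GaussianFourier.integral_rexp_neg_mul_sq_norm (V := EuclideanSpace ℝ (Fin d)) hb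
  rw [finrank_euclideanSpace_fin] at h
  rw [← h, ofReal_integral_eq_lintegral_ofReal _ (ae_of_all _ fun _ => (Real.exp_pos _).le)]
  by_contra hn
  rw [integral_undef hn] at h
  exact absurd h (by positivity)

theorem lintegral_gaussMeasure {f : EuclideanSpace ℝ (Fin d) → ℝ≥0∞} (hf : Measurable f) :
    ∫⁻ z, f z ∂gaussMeasure d = ∫⁻ z,
      ENNReal.ofReal (Real.pi ^ (-(d : ℝ) / 2) * Real.exp (-‖z‖ ^ 2)) * f z := by
  rw [gaussMeasure, lintegral_withDensity_eq_lintegral_mul _ (by fun_prop) hf]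
  rfl

instance isProbabilityMeasure_gaussMeasure : IsProbabilityMeasure (gaussMeasure d) := by
  constructor
  have h := lintegral_gaussMeasure (d := d) (f := fun _ => 1) measurable_const
  simp only [lintegral_const, one_mul, mul_one] at h
  rw [h]
  simp_rw [ENNReal.ofReal_mul (show 0 ≤ Real.pi ^ (-(d : ℝ) / 2) by positivity)]
  rw [lintegral_const_mul _ (by fun_prop)]
  have := lintegral_exp_neg_mul_sq_norm (d := d) one_pos
  simp only [neg_mul, one_mul, div_one] at this
  rw [this, ← ENNReal.ofReal_mul (by positivity), ← Real.rpow_add Real.pi_pos]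
  simp [neg_div]

theorem lintegral_gaussMeasure_sq_norm_lt_top :
    ∫⁻ z, ENNReal.ofReal (‖z‖ ^ 2) ∂gaussMeasure d < ⊤ := by
  rw [lintegral_gaussMeasure (by fun_prop)]
  calc _ ≤ ∫⁻ z : EuclideanSpace ℝ (Fin d), ENNReal.ofReal (2 * Real.pi ^ (-(d : ℝ) / 2)) *
        ENNReal.ofReal (Real.exp (-(1 / 2) * ‖z‖ ^ 2)) := by
        refine lintegral_mono fun z => ?_
        rw [← ENNReal.ofReal_mul (by positivity), ← ENNReal.ofReal_mul (by positivity)]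
        refine ENNReal.ofReal_le_ofReal ?_
        have h1 : ‖z‖ ^ 2 / 2 ≤ Real.exp (‖z‖ ^ 2 / 2) := by
          linarith [Real.add_one_le_exp (‖z‖ ^ 2 / 2)]
        have h2 : Real.exp (-(1 / 2) * ‖z‖ ^ 2) =
            Real.exp (-‖z‖ ^ 2) * Real.exp (‖z‖ ^ 2 / 2) := by
          rw [← Real.exp_add]; ring_nf
        rw [h2]
        have : 0 ≤ Real.pi ^ (-(d : ℝ) / 2) * Real.exp (-‖z‖ ^ 2) := by positivity
        nlinarith
    _ < ⊤ := by
        rw [lintegral_const_mul _ (by fun_prop), lintegral_exp_neg_mul_sq_norm (by norm_num)]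
        exact ENNReal.mul_lt_top ENNReal.ofReal_lt_top ENNReal.ofReal_lt_top

/-- Semigroup property, by completing the square in `z`. The Gaussian is normalised so that `√s • z`
has density `π ^ (-d/2)` times the heat kernel at time `s`, hence times add. -/
theorem lintegral_heatKernel_add_smul {s t : ℝ} (hs : 0 < s) (ht : 0 < t)
    (x : EuclideanSpace ℝ (Fin d)) :
    ∫⁻ z, heatKernel t (x + √s • z) ∂gaussMeasure d = heatKernel (t + s) x := by
  rw [lintegral_gaussMeasure (by fun_prop)]
  have key : ∀ z : EuclideanSpace ℝ (Fin d),
      ENNReal.ofReal (Real.pi ^ (-(d : ℝ) / 2) * Real.exp (-‖z‖ ^ 2)) *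
        heatKernel t (x + √s • z) =
      ENNReal.ofReal (Real.pi ^ (-(d : ℝ) / 2) * t ^ (-(d : ℝ) / 2) *
        Real.exp (-‖x‖ ^ 2 / (t + s))) *
        ENNReal.ofReal (Real.exp (-((t + s) / t) * ‖z + (√s / (t + s)) • x‖ ^ 2)) := by
    intro z
    rw [heatKernel, ← ENNReal.ofReal_mul (by positivity), ← ENNReal.ofReal_mul (by positivity)]
    congr 1
    have e : Real.exp (-‖z‖ ^ 2) * Real.exp (-‖x + √s • z‖ ^ 2 / t) =
        Real.exp (-‖x‖ ^ 2 / (t + s)) *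
          Real.exp (-((t + s) / t) * ‖z + (√s / (t + s)) • x‖ ^ 2) := by
      rw [← Real.exp_add, ← Real.exp_add]
      congr 1
      rw [norm_add_sq_real, norm_add_sq_real, inner_smul_right, inner_smul_right, norm_smul,
        norm_smul, mul_pow, mul_pow, real_inner_comm]
      simp only [Real.norm_eq_abs, sq_abs, div_pow, Real.sq_sqrt hs.le]
      field_simp
      ring
    calc _ = Real.pi ^ (-(d : ℝ) / 2) * t ^ (-(d : ℝ) / 2) *
          (Real.exp (-‖z‖ ^ 2) * Real.exp (-‖x + √s • z‖ ^ 2 / t)) := by ring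
      _ = _ := by rw [e]; ring
  simp_rw [key]
  rw [lintegral_const_mul _ (by fun_prop),
    lintegral_add_right_eq_self
      (fun z : EuclideanSpace ℝ (Fin d) =>
        ENNReal.ofReal (Real.exp (-((t + s) / t) * ‖z‖ ^ 2))),
    lintegral_exp_neg_mul_sq_norm (by positivity), heatKernel,
    ← ENNReal.ofReal_mul (by positivity)]
  congr 1
  have h1 : (Real.pi / ((t + s) / t)) ^ ((d : ℝ) / 2) =
      Real.pi ^ ((d : ℝ) / 2) * t ^ ((d : ℝ) / 2) * (t + s) ^ (-(d : ℝ) / 2) := by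
    rw [div_div_eq_mul_div, Real.div_rpow (by positivity) (by positivity),
      Real.mul_rpow (by positivity) (by positivity), neg_div, Real.rpow_neg (by positivity)]
    rfl
  rw [h1, neg_div, Real.rpow_neg (by positivity), Real.rpow_neg ht.le]
  field_simp

theorem heatDeficit_add_heatKernel {t : ℝ} (ht : 0 < t) (x : EuclideanSpace ℝ (Fin d)) :
    heatDeficit t x + heatKernel t x = ENNReal.ofReal (t ^ (-(d : ℝ) / 2)) := by
  have : Real.exp (-‖x‖ ^ 2 / t) ≤ 1 := by
    rw [Real.exp_le_one_iff, neg_div]; simp; positivity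
  rw [heatDeficit, heatKernel, ← ENNReal.ofReal_add (mul_nonneg (by positivity) (by linarith))
    (by positivity)]
  congr 1; ring

theorem heatKernel_lt_top (t : ℝ) (x : EuclideanSpace ℝ (Fin d)) : heatKernel t x < ⊤ :=
  ENNReal.ofReal_lt_top

theorem lintegral_heatDeficit_add_smul {s t : ℝ} (hs : 0 < s) (ht : 0 < t)
    (x : EuclideanSpace ℝ (Fin d)) :
    ∫⁻ z, heatDeficit t (x + √s • z) ∂gaussMeasure d =
      ENNReal.ofReal (t ^ (-(d : ℝ) / 2) - (t + s) ^ (-(d : ℝ) / 2)) + heatDeficit (t + s) x := by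
  have h : ∫⁻ z, heatDeficit t (x + √s • z) ∂gaussMeasure d + heatKernel (t + s) x =
      ENNReal.ofReal (t ^ (-(d : ℝ) / 2)) := by
    rw [← lintegral_heatKernel_add_smul hs ht, ← lintegral_add_left (by fun_prop)]
    simp_rw [heatDeficit_add_heatKernel ht]
    simp
  have hle : (t + s) ^ (-(d : ℝ) / 2) ≤ t ^ (-(d : ℝ) / 2) :=
    Real.rpow_le_rpow_of_nonpos ht (by linarith) (by rw [neg_div]; simp; positivity)
  rw [← ENNReal.add_left_inj (heatKernel_lt_top (t + s) x).ne, h, add_assoc,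
    heatDeficit_add_heatKernel (by positivity), ← ENNReal.ofReal_add (by linarith) (by positivity)]
  congr 1; ring

theorem lintegral_heatInt_add_smul {s a b : ℝ} (hs : 0 < s) (ha : 0 ≤ a)
    (x : EuclideanSpace ℝ (Fin d)) :
    ∫⁻ z, heatInt (Set.Ioc a b) (x + √s • z) ∂gaussMeasure d =
      heatInt (Set.Ioc (a + s) (b + s)) x := by
  unfold heatInt
  rw [lintegral_lintegral_swap]
  · rw [setLIntegral_congr_fun measurableSet_Ioc
      (fun t ht => lintegral_heatKernel_add_smul hs (ha.trans_lt ht.1) x)]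
    have := (measurePreserving_add_right (volume : Measure ℝ) s).setLIntegral_comp_preimage
      (measurableSet_Ioc (a := a + s) (b := b + s)) (measurable_heatKernel_left x)
    rw [← this]
    simp
  · exact (measurable_heatKernel.comp (by fun_prop :
      Measurable fun p : EuclideanSpace ℝ (Fin d) × ℝ => (p.2, x + √s • p.1))).aemeasurable

theorem heatInt_Ioc_add {a b c : ℝ} (hab : a ≤ b) (hbc : b ≤ c) (x : EuclideanSpace ℝ (Fin d)) :
    heatInt (Set.Ioc a b) x + heatInt (Set.Ioc b c) x = heatInt (Set.Ioc a c) x := by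
  unfold heatInt
  rw [← lintegral_union measurableSet_Ioc (Set.Ioc_disjoint_Ioc_of_le le_rfl),
    Set.Ioc_union_Ioc_eq_Ioc hab hbc]

/-- The integral of `t ^ (-d/2)` over `(1, 1 + s]`. -/
def heatMass (d : ℕ) (s : ℝ) : ℝ≥0∞ :=
  ∫⁻ t in Set.Ioc 1 (1 + s), ENNReal.ofReal (t ^ (-(d : ℝ) / 2))

/-- The constant `∫ t > 1, (t ^ (-d/2) - (t + s) ^ (-d/2))`. -/
def heatGap (d : ℕ) (s : ℝ) : ℝ≥0∞ :=
  ∫⁻ t in Set.Ioi (1 : ℝ), ENNReal.ofReal (t ^ (-(d : ℝ) / 2) - (t + s) ^ (-(d : ℝ) / 2))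

theorem heatMass_le {s : ℝ} : heatMass d s ≤ ENNReal.ofReal s := by
  calc heatMass d s ≤ ∫⁻ t in Set.Ioc 1 (1 + s), 1 := by
        refine setLIntegral_mono measurable_const fun t ht => ?_
        rw [← ENNReal.ofReal_one]
        refine ENNReal.ofReal_le_ofReal (Real.rpow_le_one_of_one_le_of_nonpos ht.1.le ?_)
        rw [neg_div]; simp; positivity
    _ = _ := by simp

/-- Averaging shifts the times `t > 1` to `t > 1 + s`, at the cost of the constant `heatGap`. On the
lost window `(1, 1 + s]`, deficit and heat kernel add up to `t ^ (-d/2)`, which produces `heatMass`.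
-/
theorem lintegral_deficitInt_add_smul {s : ℝ} (hs : 0 < s) (x : EuclideanSpace ℝ (Fin d)) :
    ∫⁻ z, deficitInt (x + √s • z) ∂gaussMeasure d + heatMass d s =
      heatGap d s + deficitInt x + heatInt (Set.Ioc 1 (1 + s)) x := by
  have h1 : ∫⁻ z, deficitInt (x + √s • z) ∂gaussMeasure d =
      heatGap d s + ∫⁻ t in Set.Ioi (1 + s), heatDeficit t x := by
    unfold deficitInt
    rw [lintegral_lintegral_swap]
    · rw [setLIntegral_congr_fun measurableSet_Ioi
        (fun t ht => lintegral_heatDeficit_add_smul hs (zero_lt_one.trans ht) x)]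
      rw [lintegral_add_left (by fun_prop)]
      congr 1
      have := (measurePreserving_add_right (volume : Measure ℝ) s).setLIntegral_comp_preimage
        (measurableSet_Ioi (a := 1 + s)) (measurable_heatDeficit_left x)
      rw [← this]
      simp
    · exact (measurable_heatDeficit.comp (by fun_prop :
        Measurable fun p : EuclideanSpace ℝ (Fin d) × ℝ => (p.2, x + √s • p.1))).aemeasurable
  have h2 : deficitInt x = (∫⁻ t in Set.Ioc 1 (1 + s), heatDeficit t x) +
      ∫⁻ t in Set.Ioi (1 + s), heatDeficit t x := by
    rw [← lintegral_union measurableSet_Ioi, Set.Ioc_union_Ioi_eq_Ioi (by linarith)]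
    · rfl
    · exact Set.disjoint_left.2 fun t ht ht' => not_lt.2 ht.2 ht'
  have h3 : heatMass d s = (∫⁻ t in Set.Ioc 1 (1 + s), heatDeficit t x) +
      heatInt (Set.Ioc 1 (1 + s)) x := by
    rw [heatInt, ← lintegral_add_left (by fun_prop)]
    exact (setLIntegral_congr_fun measurableSet_Ioc fun t ht =>
      heatDeficit_add_heatKernel (zero_lt_one.trans ht.1) x).symm
  rw [h1, h2, h3]
  ring

/-- The Gaussian average of the kernel `heatInt (0, 1] - deficitInt`, compared with the kernel. -/
theorem heatInt_add_lintegral_deficitInt {s : ℝ} (hs : 0 < s) (x : EuclideanSpace ℝ (Fin d)) :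
    heatInt (Set.Ioc 0 1) x + ∫⁻ z, deficitInt (x + √s • z) ∂gaussMeasure d + heatMass d s =
      ∫⁻ z, heatInt (Set.Ioc 0 1) (x + √s • z) ∂gaussMeasure d + heatInt (Set.Ioc 0 s) x
        + deficitInt x + heatGap d s := by
  rw [add_assoc, lintegral_deficitInt_add_smul hs, lintegral_heatInt_add_smul hs le_rfl]
  have h1 := heatInt_Ioc_add (a := 0) (b := 1) (c := 1 + s) (by norm_num) (by linarith) x
  have h2 := heatInt_Ioc_add (a := 0) (b := s) (c := 1 + s) hs.le (by linarith) x
  rw [zero_add]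
  calc _ = (heatInt (Set.Ioc 0 1) x + heatInt (Set.Ioc 1 (1 + s)) x)
        + heatGap d s + deficitInt x := by ring
    _ = _ := by rw [h1, ← h2]; ring

theorem heatInt_Ioc_one_le {s : ℝ} (x : EuclideanSpace ℝ (Fin d)) :
    heatInt (Set.Ioc 1 (1 + s)) x ≤ ENNReal.ofReal s := by
  refine le_trans ?_ (heatMass_le (d := d))
  refine setLIntegral_mono (by fun_prop) fun t ht => ?_
  rw [← heatDeficit_add_heatKernel (zero_lt_one.trans ht.1) x]
  exact le_add_self

theorem lintegral_heatInt_add_smul_le {s : ℝ} (hs : 0 < s) (x : EuclideanSpace ℝ (Fin d)) :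
    ∫⁻ z, heatInt (Set.Ioc 0 1) (x + √s • z) ∂gaussMeasure d ≤
      heatInt (Set.Ioc 0 1) x + ENNReal.ofReal s := by
  rw [lintegral_heatInt_add_smul hs le_rfl, zero_add]
  have h1 := heatInt_Ioc_add (a := 0) (b := 1) (c := 1 + s) (by norm_num) (by linarith) x
  have h2 := heatInt_Ioc_add (a := 0) (b := s) (c := 1 + s) hs.le (by linarith) x
  calc _ ≤ heatInt (Set.Ioc 0 (1 + s)) x := h2 ▸ le_add_self
    _ = _ := h1.symm
    _ ≤ _ := by gcongr; exact heatInt_Ioc_one_le x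

theorem deficitInt_le_of_norm_le {x y : EuclideanSpace ℝ (Fin d)} (h : ‖x‖ ≤ ‖y‖) :
    deficitInt x ≤ deficitInt y := by
  refine setLIntegral_mono (by fun_prop) fun t ht => ?_
  have ht : 0 < t := zero_lt_one.trans ht
  unfold heatDeficit
  gcongr

/-- With `q = exp (-‖x‖² / t)`, doubling `x` replaces `q` by `q ^ 4`, and Bernoulli's inequality
gives `1 - q ^ 4 ≤ 4 (1 - q)`. This doubling bound yields the quasi-triangle inequality below. -/
theorem deficitInt_two_smul_le (x : EuclideanSpace ℝ (Fin d)) :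
    deficitInt ((2 : ℝ) • x) ≤ 4 * deficitInt x := by
  unfold deficitInt
  rw [← lintegral_const_mul _ (by fun_prop)]
  refine setLIntegral_mono (by fun_prop) fun t ht => ?_
  have ht : 0 < t := zero_lt_one.trans ht
  unfold heatDeficit
  rw [show (4 : ℝ≥0∞) = ENNReal.ofReal 4 by simp, ← ENNReal.ofReal_mul (by norm_num)]
  refine ENNReal.ofReal_le_ofReal ?_
  have e : Real.exp (-‖(2 : ℝ) • x‖ ^ 2 / t) = Real.exp (-‖x‖ ^ 2 / t) ^ 4 := by
    rw [← Real.exp_nat_mul, norm_smul]; congr 1; norm_num; ring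
  rw [e, mul_left_comm]
  gcongr
  have h := one_add_mul_le_pow (a := Real.exp (-‖x‖ ^ 2 / t) - 1)
    (by linarith [Real.exp_pos (-‖x‖ ^ 2 / t)]) 4
  push_cast at h
  rw [add_sub_cancel] at h
  linarith

theorem deficitInt_add_le (x y : EuclideanSpace ℝ (Fin d)) :
    deficitInt (x + y) ≤ 4 * deficitInt x + 4 * deficitInt y := by
  have h := norm_add_le x y
  rcases le_total ‖x‖ ‖y‖ with hxy | hxy
  · refine le_trans (deficitInt_le_of_norm_le (y := (2 : ℝ) • y) ?_)
      ((deficitInt_two_smul_le y).trans le_add_self)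
    rw [norm_smul]; norm_num; linarith
  · refine le_trans (deficitInt_le_of_norm_le (y := (2 : ℝ) • x) ?_)
      ((deficitInt_two_smul_le x).trans le_self_add)
    rw [norm_smul]; norm_num; linarith

/-- From `1 - exp (-a) ≤ a` the integrand is at most `‖x‖² t ^ (-d/2 - 1) ≤ ‖x‖² t ^ (-3/2)`, and
the integral of `t ^ (-3/2)` over `t > 1` is 2. -/
theorem deficitInt_le_sq (hd : 1 ≤ d) (x : EuclideanSpace ℝ (Fin d)) :
    deficitInt x ≤ 2 * ENNReal.ofReal (‖x‖ ^ 2) := by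
  calc deficitInt x ≤ ∫⁻ t in Set.Ioi (1 : ℝ),
        ENNReal.ofReal (‖x‖ ^ 2) * ENNReal.ofReal (t ^ (-(3 : ℝ) / 2)) := by
        refine setLIntegral_mono (by fun_prop) fun t ht => ?_
        have ht1 : 1 < t := ht
        have ht : 0 < t := zero_lt_one.trans ht
        rw [← ENNReal.ofReal_mul (by positivity), heatDeficit]
        refine ENNReal.ofReal_le_ofReal ?_
        have h1 : 1 - Real.exp (-‖x‖ ^ 2 / t) ≤ ‖x‖ ^ 2 / t := by
          have := Real.add_one_le_exp (-‖x‖ ^ 2 / t)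
          rw [neg_div] at *; linarith
        have h2 : t ^ (-(d : ℝ) / 2) ≤ t ^ (-(1 : ℝ) / 2) := by
          refine Real.rpow_le_rpow_of_exponent_le ht1.le ?_
          have : (1 : ℝ) ≤ d := by exact_mod_cast hd
          linarith
        have h3 : t ^ (-(3 : ℝ) / 2) = t ^ (-(1 : ℝ) / 2) * t⁻¹ := by
          rw [← Real.rpow_neg_one, ← Real.rpow_add ht]; norm_num
        calc _ ≤ t ^ (-(1 : ℝ) / 2) * (‖x‖ ^ 2 / t) := by
              refine mul_le_mul h2 h1 ?_ (by positivity)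
              rw [sub_nonneg, Real.exp_le_one_iff, neg_div, neg_nonpos]
              positivity
          _ = _ := by rw [h3]; ring
    _ = _ := by
        rw [lintegral_const_mul _ (by fun_prop), mul_comm]
        congr 1
        rw [← ofReal_integral_eq_lintegral_ofReal
          (integrableOn_Ioi_rpow_of_lt (by norm_num) one_pos),
          integral_Ioi_rpow_of_lt (by norm_num) one_pos]
        · norm_num
        · filter_upwards [ae_restrict_mem measurableSet_Ioi] with t ht
          have : 0 < t := zero_lt_one.trans ht
          positivity

theorem lintegral_deficitInt_smul_lt_top (hd : 1 ≤ d) (s : ℝ) :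
    ∫⁻ z : EuclideanSpace ℝ (Fin d), deficitInt (s • z) ∂gaussMeasure d < ⊤ := by
  calc _ ≤ ∫⁻ z : EuclideanSpace ℝ (Fin d),
        (2 * ENNReal.ofReal (s ^ 2)) * ENNReal.ofReal (‖z‖ ^ 2) ∂gaussMeasure d := by
        refine lintegral_mono fun z => (deficitInt_le_sq hd _).trans_eq ?_
        rw [norm_smul, mul_pow, ENNReal.ofReal_mul (by positivity), mul_assoc]
        simp
    _ < ⊤ := by
        rw [lintegral_const_mul _ (by fun_prop)]
        exact ENNReal.mul_lt_top (ENNReal.mul_lt_top (by simp) ENNReal.ofReal_lt_top)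
          lintegral_gaussMeasure_sq_norm_lt_top

/-- The averaging identity at `x = 0` exhibits the gap as a summand of a finite quantity. -/
theorem heatGap_lt_top (hd : 1 ≤ d) {s : ℝ} (hs : 0 < s) : heatGap d s < ⊤ := by
  have h := lintegral_deficitInt_add_smul (d := d) hs 0
  simp only [zero_add] at h
  calc heatGap d s ≤ ∫⁻ z : EuclideanSpace ℝ (Fin d), deficitInt (√s • z) ∂gaussMeasure d
        + heatMass d s := by rw [h, add_assoc]; exact le_self_add
    _ < ⊤ := ENNReal.add_lt_top.2 ⟨lintegral_deficitInt_smul_lt_top hd _,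
        heatMass_le.trans_lt ENNReal.ofReal_lt_top⟩

end HeatKernel

/-! ### Heat kernel decomposition of the Coulomb kernel -/

section Coulomb

variable {d : ℕ}

/-- The Coulomb potential as a function of the square of the distance. -/
def coulombProfile (d : ℕ) (ρ : ℝ) : ℝ :=
  if d = 2 then -(1 / 2) * Real.log ρ else ρ ^ ((2 - (d : ℝ)) / 2) / ((d : ℝ) - 2)

/-- The profile is an antiderivative of `-ρ ^ (-d/2) / 2`. The endpoint `a = 0` is admitted only for
`d = 1`, where the singularity is integrable. -/
theorem integral_rpow_eq_coulombProfile {a b : ℝ} (hab : a ≤ b)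
    (had : 0 < a ∨ d = 1) :
    IntervalIntegrable (fun ρ : ℝ => ρ ^ (-(d : ℝ) / 2)) volume a b ∧
      ∫ ρ in a..b, ρ ^ (-(d : ℝ) / 2) = 2 * (coulombProfile d a - coulombProfile d b) := by
  have hnot : 0 < a → (0 : ℝ) ∉ Set.uIcc a b := fun h => by
    rw [Set.uIcc_of_le hab]; exact fun h' => absurd h'.1 (not_le.2 h)
  have hcond : -1 < -(d : ℝ) / 2 ∨ (0 : ℝ) ∉ Set.uIcc a b := by
    rcases had with h | h
    · exact Or.inr (hnot h)
    · left; subst h; norm_num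
  refine ⟨?_, ?_⟩
  · rcases hcond with h | h
    · exact intervalIntegral.intervalIntegrable_rpow' h
    · exact intervalIntegral.intervalIntegrable_rpow (Or.inr h)
  by_cases h2 : d = 2
  · subst h2
    have ha' : 0 < a := by rcases had with h | h <;> [exact h; omega]
    have : ∀ ρ : ℝ, ρ ^ (-((2 : ℕ) : ℝ) / 2) = ρ⁻¹ := fun ρ => by
      rw [← Real.rpow_neg_one]; norm_num
    simp_rw [this]
    rw [integral_inv (hnot ha'), Real.log_div (by linarith) ha'.ne']
    simp [coulombProfile]; ring
  · have hd2 : (d : ℝ) - 2 ≠ 0 := fun h => h2 (by exact_mod_cast (sub_eq_zero.1 h))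
    rw [integral_rpow]
    · simp only [coulombProfile, h2, if_false]
      rw [show -(d : ℝ) / 2 + 1 = (2 - (d : ℝ)) / 2 by ring]
      have : (2 - (d : ℝ)) ≠ 0 := fun h => hd2 (by linarith)
      field_simp
      ring
    · rcases hcond with h | h
      · exact Or.inl h
      · exact Or.inr ⟨fun h' => hd2 (by linarith), h⟩

theorem coulombProfile_anti {a b : ℝ} (ha : 0 ≤ a) (hab : a ≤ b) (had : 0 < a ∨ d = 1) :
    coulombProfile d b ≤ coulombProfile d a := by
  have h := (integral_rpow_eq_coulombProfile hab had).2
  have : 0 ≤ ∫ ρ in a..b, ρ ^ (-(d : ℝ) / 2) :=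
    intervalIntegral.integral_nonneg hab fun ρ hρ => Real.rpow_nonneg (ha.trans hρ.1) _
  linarith

theorem setLIntegral_rpow_eq_coulombProfile {a b : ℝ} (ha : 0 ≤ a) (hab : a ≤ b)
    (had : 0 < a ∨ d = 1) :
    ∫⁻ ρ in Set.Ioc a b, ENNReal.ofReal (ρ ^ (-(d : ℝ) / 2)) =
      ENNReal.ofReal (2 * (coulombProfile d a - coulombProfile d b)) := by
  obtain ⟨hint, h⟩ := integral_rpow_eq_coulombProfile hab had
  rw [← ofReal_integral_eq_lintegral_ofReal
    ((intervalIntegrable_iff_integrableOn_Ioc_of_le hab).1 hint),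
    ← intervalIntegral.integral_of_le hab, h]
  filter_upwards [ae_restrict_mem measurableSet_Ioc] with ρ hρ
  have := ha.trans_lt hρ.1
  positivity

/-- The substitution `t ↦ 1 / t` turns this into Euler's integral for the Gamma function. -/
theorem lintegral_heat_time {ρ : ℝ} (hd : 1 ≤ d) (hρ : 0 < ρ) :
    ∫⁻ t in Set.Ioi (0 : ℝ), ENNReal.ofReal (t ^ (-(d : ℝ) / 2 - 1) * Real.exp (-ρ / t)) =
      ENNReal.ofReal (Real.Gamma ((d : ℝ) / 2)) * ENNReal.ofReal (ρ ^ (-(d : ℝ) / 2)) := by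
  have hd0 : (0 : ℝ) < (d : ℝ) / 2 := by
    have : (0 : ℝ) < d := by exact_mod_cast hd
    positivity
  have h1 := Real.integral_rpow_mul_exp_neg_mul_Ioi hd0 hρ
  rw [← integral_comp_rpow_Ioi _ (show (-1 : ℝ) ≠ 0 by norm_num)] at h1
  have h2 : ∀ t ∈ Set.Ioi (0 : ℝ), (|(-1 : ℝ)| * t ^ ((-1 : ℝ) - 1)) •
      ((t ^ (-1 : ℝ)) ^ ((d : ℝ) / 2 - 1) * Real.exp (-(ρ * t ^ (-1 : ℝ)))) =
      t ^ (-(d : ℝ) / 2 - 1) * Real.exp (-ρ / t) := by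
    intro t ht
    have ht : 0 < t := ht
    rw [← Real.rpow_mul ht.le, smul_eq_mul, abs_neg, abs_one, one_mul, ← mul_assoc,
      ← Real.rpow_add ht, Real.rpow_neg_one]
    congr 2
    · ring
    · rw [neg_div, div_eq_mul_inv]
  rw [setIntegral_congr_fun measurableSet_Ioi h2] at h1
  have h3 : (1 / ρ) ^ ((d : ℝ) / 2) = ρ ^ (-(d : ℝ) / 2) := by
    rw [neg_div, Real.rpow_neg hρ.le, Real.div_rpow zero_le_one hρ.le, Real.one_rpow, one_div]
  rw [h3] at h1
  have hG := Real.Gamma_pos_of_pos hd0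
  rw [← ENNReal.ofReal_mul hG.le, mul_comm, ← h1, ofReal_integral_eq_lintegral_ofReal]
  · by_contra hn
    rw [integral_undef hn] at h1
    exact absurd h1 (by positivity)
  · filter_upwards [ae_restrict_mem measurableSet_Ioi] with t ht
    have : 0 < t := ht
    positivity

theorem lintegral_heat_sq {a b t : ℝ} (hab : a ≤ b) (ht : 0 < t) :
    ∫⁻ ρ in Set.Ioc a b, ENNReal.ofReal (t ^ (-(d : ℝ) / 2 - 1) * Real.exp (-ρ / t)) =
      ENNReal.ofReal (t ^ (-(d : ℝ) / 2) * (Real.exp (-a / t) - Real.exp (-b / t))) := by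
  have hc : Continuous fun ρ : ℝ => t ^ (-(d : ℝ) / 2 - 1) * Real.exp (-ρ / t) := by fun_prop
  rw [← ofReal_integral_eq_lintegral_ofReal
    ((intervalIntegrable_iff_integrableOn_Ioc_of_le hab).1 (hc.intervalIntegrable a b))
    (ae_of_all _ fun ρ => by positivity), ← intervalIntegral.integral_of_le hab]
  congr 1
  have hder : ∀ ρ ∈ Set.uIcc a b, HasDerivAt
      (fun ρ : ℝ => -(t ^ (-(d : ℝ) / 2) * Real.exp (-ρ / t)))
      (t ^ (-(d : ℝ) / 2 - 1) * Real.exp (-ρ / t)) ρ := by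
    intro ρ _
    have h := (((hasDerivAt_id ρ).neg.div_const t).exp.const_mul (t ^ (-(d : ℝ) / 2))).neg
    refine h.congr_deriv ?_
    rw [Real.rpow_sub_one ht.ne']
    simp
    ring
  rw [intervalIntegral.integral_eq_sub_of_hasDerivAt hder (hc.intervalIntegrable a b)]
  ring

/-- Integrate `t ^ (-d/2 - 1) exp (-ρ / t)` over `t > 0` and `a < ρ ≤ b` in both orders. Working
with differences avoids the divergence at large times for `d ≤ 2`. -/
theorem lintegral_heat_diff {a b : ℝ} (hd : 1 ≤ d) (ha : 0 ≤ a) (hab : a ≤ b)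
    (had : 0 < a ∨ d = 1) :
    ∫⁻ t in Set.Ioi (0 : ℝ),
        ENNReal.ofReal (t ^ (-(d : ℝ) / 2) * (Real.exp (-a / t) - Real.exp (-b / t))) =
      ENNReal.ofReal (2 * Real.Gamma ((d : ℝ) / 2)) *
        ENNReal.ofReal (coulombProfile d a - coulombProfile d b) := by
  rw [← setLIntegral_congr_fun measurableSet_Ioi fun t ht => lintegral_heat_sq (d := d) hab ht,
    lintegral_lintegral_swap (Measurable.aemeasurable (by fun_prop)),
    setLIntegral_congr_fun measurableSet_Ioc
      fun ρ hρ => lintegral_heat_time hd (ha.trans_lt hρ.1),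
    lintegral_const_mul _ (by fun_prop), setLIntegral_rpow_eq_coulombProfile ha hab had,
    ENNReal.ofReal_mul (by norm_num), mul_comm (2 : ℝ), ENNReal.ofReal_mul' (by norm_num)]
  ring

theorem heatInt_Ioc_zero_one_lt_top {x : EuclideanSpace ℝ (Fin d)} (hd : 1 ≤ d)
    (hx : x ≠ 0 ∨ d = 1) : heatInt (Set.Ioc 0 1) x < ⊤ := by
  rcases hx with hx | rfl
  · have hx : 0 < ‖x‖ ^ 2 := by positivity
    calc heatInt (Set.Ioc 0 1) x ≤ ∫⁻ t in Set.Ioi (0 : ℝ),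
          ENNReal.ofReal (t ^ (-(d : ℝ) / 2 - 1) * Real.exp (-‖x‖ ^ 2 / t)) := by
          refine le_trans (setLIntegral_mono (by fun_prop) fun t ht => ?_)
            (lintegral_mono_set Set.Ioc_subset_Ioi_self)
          refine ENNReal.ofReal_le_ofReal ?_
          gcongr ?_ * _
          exact Real.rpow_le_rpow_of_exponent_ge ht.1 ht.2 (by linarith)
      _ < ⊤ := by
          rw [lintegral_heat_time hd hx]
          exact ENNReal.mul_lt_top ENNReal.ofReal_lt_top ENNReal.ofReal_lt_top
  · calc heatInt (Set.Ioc 0 1) x ≤ ∫⁻ t in Set.Ioc (0 : ℝ) 1,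
          ENNReal.ofReal (t ^ (-((1 : ℕ) : ℝ) / 2)) := by
          refine setLIntegral_mono (by fun_prop) fun t ht => ?_
          rw [← heatDeficit_add_heatKernel ht.1 x]
          exact le_add_self
      _ < ⊤ := by
          rw [setLIntegral_rpow_eq_coulombProfile le_rfl zero_le_one (Or.inr rfl)]
          exact ENNReal.ofReal_lt_top

theorem deficitInt_lt_top (hd : 1 ≤ d) (x : EuclideanSpace ℝ (Fin d)) : deficitInt x < ⊤ :=
  (deficitInt_le_sq hd x).trans_lt (ENNReal.mul_lt_top (by simp) ENNReal.ofReal_lt_top)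

theorem heatInt_Ioc_zero_one_zero (hd : 2 ≤ d) :
    heatInt (Set.Ioc 0 1) (0 : EuclideanSpace ℝ (Fin d)) = ⊤ := by
  by_contra hn
  have h : ∫⁻ t in Set.Ioc (0 : ℝ) 1, ENNReal.ofReal t⁻¹ ≠ ⊤ := by
    refine ne_top_of_le_ne_top hn (setLIntegral_mono (by fun_prop) fun t ht => ?_)
    refine ENNReal.ofReal_le_ofReal ?_
    rw [← Real.rpow_neg_one]
    simp only [norm_zero, ne_eq, OfNat.ofNat_ne_zero, not_false_eq_true, zero_pow, neg_zero,
      zero_div, Real.exp_zero, mul_one]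
    refine Real.rpow_le_rpow_of_exponent_ge ht.1 ht.2 ?_
    have : (2 : ℝ) ≤ d := by exact_mod_cast hd
    linarith
  have hint : IntegrableOn (fun t : ℝ => t⁻¹) (Set.Ioc 0 1) := by
    refine ⟨by fun_prop, ?_⟩
    rw [hasFiniteIntegral_iff_ofReal]
    · exact h.lt_top
    · filter_upwards [ae_restrict_mem measurableSet_Ioc] with t ht
      exact inv_nonneg.2 ht.1.le
  have := (intervalIntegrable_iff_integrableOn_Ioc_of_le zero_le_one).2 hint
  rw [intervalIntegrable_inv_iff] at this
  simp at this

theorem heatInt_le_of_norm_le {x y : EuclideanSpace ℝ (Fin d)} (h : ‖x‖ ≤ ‖y‖) :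
    heatInt (Set.Ioc 0 1) y ≤ heatInt (Set.Ioc 0 1) x := by
  refine setLIntegral_mono (by fun_prop) fun t ht => ?_
  have ht : 0 < t := ht.1
  unfold heatKernel
  gcongr

/-- The multiplicative constant in the heat kernel decomposition of the Coulomb kernel. -/
def coulombConst (d : ℕ) : ℝ := (2 * Real.Gamma ((d : ℝ) / 2))⁻¹

theorem coulombConst_pos (hd : 1 ≤ d) : 0 < coulombConst d := by
  have : (0 : ℝ) < d := by exact_mod_cast hd
  have := Real.Gamma_pos_of_pos (show 0 < (d : ℝ) / 2 by positivity)
  unfold coulombConst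
  positivity

/-- Split the time integral of the previous difference formula at `t = 1`: before 1 it is a
difference of heat integrals, after 1 a difference of deficits in the opposite order. -/
theorem ofReal_coulombProfile_sub {x y : EuclideanSpace ℝ (Fin d)} (hd : 1 ≤ d)
    (hxy : ‖x‖ ≤ ‖y‖) (hx : x ≠ 0 ∨ d = 1) :
    ENNReal.ofReal (coulombProfile d (‖x‖ ^ 2) - coulombProfile d (‖y‖ ^ 2)) +
      ENNReal.ofReal (coulombConst d) * (heatInt (Set.Ioc 0 1) y + deficitInt x) =
      ENNReal.ofReal (coulombConst d) * (heatInt (Set.Ioc 0 1) x + deficitInt y) := by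
  set D : ℝ → ℝ≥0∞ := fun t => ENNReal.ofReal
    (t ^ (-(d : ℝ) / 2) * (Real.exp (-‖x‖ ^ 2 / t) - Real.exp (-‖y‖ ^ 2 / t))) with hD
  have hDm : Measurable D := by fun_prop
  have hle : ∀ t : ℝ, 0 < t → Real.exp (-‖y‖ ^ 2 / t) ≤ Real.exp (-‖x‖ ^ 2 / t) := by
    intro t ht; gcongr
  have hle1 : ∀ t : ℝ, 0 < t → Real.exp (-‖x‖ ^ 2 / t) ≤ 1 := by
    intro t ht; rw [Real.exp_le_one_iff, neg_div, neg_nonpos]; positivity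
  have h0 := lintegral_heat_diff (d := d) hd (sq_nonneg ‖x‖)
    (pow_le_pow_left₀ (norm_nonneg x) hxy 2) (hx.imp (fun h => by positivity) id)
  have hc := coulombConst_pos hd
  have h1 : ENNReal.ofReal (coulombProfile d (‖x‖ ^ 2) - coulombProfile d (‖y‖ ^ 2)) =
      ENNReal.ofReal (coulombConst d) * ∫⁻ t in Set.Ioi (0 : ℝ), D t := by
    rw [h0, ← mul_assoc, ← ENNReal.ofReal_mul hc.le, coulombConst, inv_mul_cancel₀]
    · simp
    · unfold coulombConst at hc
      exact (inv_pos.1 hc).ne'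
  have h2 : ∫⁻ t in Set.Ioi (0 : ℝ), D t =
      (∫⁻ t in Set.Ioc (0 : ℝ) 1, D t) + ∫⁻ t in Set.Ioi (1 : ℝ), D t := by
    rw [← lintegral_union measurableSet_Ioi, Set.Ioc_union_Ioi_eq_Ioi zero_le_one]
    exact Set.disjoint_left.2 fun t ht ht' => not_lt.2 ht.2 ht'
  have h3 : (∫⁻ t in Set.Ioc (0 : ℝ) 1, D t) + heatInt (Set.Ioc 0 1) y =
      heatInt (Set.Ioc 0 1) x := by
    unfold heatInt
    rw [← lintegral_add_left hDm]
    refine setLIntegral_congr_fun measurableSet_Ioc fun t ht => ?_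
    have ht0 : 0 < t := ht.1
    simp only [hD, heatKernel]
    rw [← ENNReal.ofReal_add (mul_nonneg (by positivity) (sub_nonneg.2 (hle t ht0)))
      (by positivity)]
    congr 1; ring
  have h4 : (∫⁻ t in Set.Ioi (1 : ℝ), D t) + deficitInt x = deficitInt y := by
    unfold deficitInt
    rw [← lintegral_add_left hDm]
    refine setLIntegral_congr_fun measurableSet_Ioi fun t ht => ?_
    have ht0 : 0 < t := zero_lt_one.trans ht
    simp only [hD, heatDeficit]
    rw [← ENNReal.ofReal_add (mul_nonneg (by positivity) (sub_nonneg.2 (hle t ht0)))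
      (mul_nonneg (by positivity) (sub_nonneg.2 (hle1 t ht0)))]
    congr 1; ring
  rw [h1, h2, ← mul_add, ← h3, ← h4]
  congr 1; ring

theorem coulombKernel_of_ne {x y : EuclideanSpace ℝ (Fin d)} (hxy : x - y ≠ 0 ∨ d = 1) :
    coulombKernel d x y = (coulombProfile d (‖x - y‖ ^ 2) : EReal) := by
  unfold coulombKernel rieszKernel coulombProfile
  rw [edist_dist, dist_eq_norm]
  have hsq : ∀ p : ℝ, (‖x - y‖ ^ 2) ^ (p / 2) = ‖x - y‖ ^ p := fun p => by
    rw [← Real.rpow_natCast, ← Real.rpow_mul (norm_nonneg _)]; congr 1; push_cast; ring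
  by_cases h2 : d = 2
  · have h : 0 < ‖x - y‖ := by
      rcases hxy with h | h
      · exact norm_pos_iff.2 h
      · omega
    subst h2
    rw [if_pos (by norm_num), if_pos rfl, ENNReal.log_ofReal_of_pos h, ← EReal.coe_neg,
      Real.log_pow]
    congr 1; push_cast; ring
  · have hd2 : (d : ℝ) - 2 ≠ 0 := fun h => h2 (by exact_mod_cast (sub_eq_zero.1 h))
    rw [if_neg hd2, if_neg h2, hsq, neg_sub, EReal.coe_div]
    congr 1
    rcases hxy with h | h
    · rw [ENNReal.ofReal_rpow_of_pos (norm_pos_iff.2 h), EReal.coe_ennreal_ofReal,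
        max_eq_left (by positivity)]
    · rw [ENNReal.ofReal_rpow_of_nonneg (norm_nonneg _) (by subst h; norm_num),
        EReal.coe_ennreal_ofReal, max_eq_left (by positivity)]

theorem coulombKernel_self (hd : 2 ≤ d) (x : EuclideanSpace ℝ (Fin d)) :
    coulombKernel d x x = ⊤ := by
  unfold coulombKernel rieszKernel
  by_cases h2 : d = 2
  · subst h2; simp
  · have hd2 : (0 : ℝ) < (d : ℝ) - 2 := by
      have : (2 : ℝ) < d := by exact_mod_cast (lt_of_le_of_ne hd (Ne.symm h2))
      linarith
    rw [if_neg hd2.ne', edist_self, ENNReal.zero_rpow_of_neg (by linarith)]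
    simp only [EReal.coe_ennreal_top]
    exact EReal.top_div_of_pos_ne_top (by exact_mod_cast hd2) (EReal.coe_ne_top _)

theorem ofReal_add_ofReal_neg_of_eq {g p n c : ℝ} (hp : 0 ≤ p) (hn : 0 ≤ n) (h : g = p - n + c) :
    ENNReal.ofReal g + ENNReal.ofReal n + ENNReal.ofReal (-c) =
      ENNReal.ofReal (-g) + ENNReal.ofReal p + ENNReal.ofReal c := by
  rcases le_total 0 g with hg | hg <;> rcases le_total 0 c with hc | hc
  · rw [ENNReal.ofReal_of_nonpos (neg_nonpos.2 hg), ENNReal.ofReal_of_nonpos (neg_nonpos.2 hc),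
      ← ENNReal.ofReal_add hg hn, zero_add, add_zero, ← ENNReal.ofReal_add hp hc]
    congr 1; linarith
  · rw [ENNReal.ofReal_of_nonpos (neg_nonpos.2 hg), ENNReal.ofReal_of_nonpos hc,
      ← ENNReal.ofReal_add hg hn, zero_add, add_zero, ← ENNReal.ofReal_add (by linarith)
      (by linarith)]
    congr 1; linarith
  · rw [ENNReal.ofReal_of_nonpos hg, ENNReal.ofReal_of_nonpos (neg_nonpos.2 hc),
      ← ENNReal.ofReal_add (by linarith) hp, zero_add, add_zero, ← ENNReal.ofReal_add (by linarith)
      (by linarith)]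
    congr 1; linarith
  · rw [ENNReal.ofReal_of_nonpos hg, ENNReal.ofReal_of_nonpos hc,
      ← ENNReal.ofReal_add (by linarith) hp, zero_add, add_zero, ← ENNReal.ofReal_add (by linarith)
      (by linarith)]
    congr 1; linarith

/-- Decomposition of the Coulomb kernel into a positive multiple of
`heatInt (0, 1] - deficitInt` and a constant. -/
theorem exists_coulombKernel_decomposition (hd : 1 ≤ d) :
    ∃ C : ℝ, ∀ x y : EuclideanSpace ℝ (Fin d),
      (coulombKernel d x y).toENNReal +
          ENNReal.ofReal (coulombConst d) * deficitInt (x - y) + ENNReal.ofReal (-C) =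
        (-coulombKernel d x y).toENNReal +
          ENNReal.ofReal (coulombConst d) * heatInt (Set.Ioc 0 1) (x - y) + ENNReal.ofReal C := by
  -- Only differences of potentials are known, so the additive constant is fixed by comparison with
  -- a unit vector.
  set e : EuclideanSpace ℝ (Fin d) := EuclideanSpace.single ⟨0, hd⟩ 1 with he
  have hen : ‖e‖ = 1 := by simp [he]
  have he0 : e ≠ 0 := by rw [← norm_ne_zero_iff, hen]; exact one_ne_zero
  have hc := coulombConst_pos hd
  set c := coulombConst d
  refine ⟨coulombProfile d 1 - c * (heatInt (Set.Ioc 0 1) e).toReal + c * (deficitInt e).toReal,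
    fun x y => ?_⟩
  by_cases hxy : x - y ≠ 0 ∨ d = 1
  · rw [coulombKernel_of_ne hxy]
    have hP := (heatInt_Ioc_zero_one_lt_top hd hxy).ne
    have hN := (deficitInt_lt_top hd (x - y)).ne
    have hPe := (heatInt_Ioc_zero_one_lt_top hd (Or.inl he0)).ne
    have hNe := (deficitInt_lt_top hd e).ne
    have hreal : coulombProfile d (‖x - y‖ ^ 2) = c * (heatInt (Set.Ioc 0 1) (x - y)).toReal -
        c * (deficitInt (x - y)).toReal + (coulombProfile d 1 -
          c * (heatInt (Set.Ioc 0 1) e).toReal + c * (deficitInt e).toReal) := by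
      have aux : ∀ u v : EuclideanSpace ℝ (Fin d), ‖u‖ ≤ ‖v‖ → (u ≠ 0 ∨ d = 1) →
          (v ≠ 0 ∨ d = 1) →
          coulombProfile d (‖u‖ ^ 2) - coulombProfile d (‖v‖ ^ 2) +
            c * ((heatInt (Set.Ioc 0 1) v).toReal + (deficitInt u).toReal) =
            c * ((heatInt (Set.Ioc 0 1) u).toReal + (deficitInt v).toReal) := by
        intro u v huv hu hv
        have h := congrArg ENNReal.toReal (ofReal_coulombProfile_sub hd huv hu)
        have hPu := (heatInt_Ioc_zero_one_lt_top hd hu).ne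
        have hPv := (heatInt_Ioc_zero_one_lt_top hd hv).ne
        have hNu := (deficitInt_lt_top hd u).ne
        have hNv := (deficitInt_lt_top hd v).ne
        have hpos : 0 ≤ coulombProfile d (‖u‖ ^ 2) - coulombProfile d (‖v‖ ^ 2) :=
          sub_nonneg.2 (coulombProfile_anti (sq_nonneg ‖u‖)
            (pow_le_pow_left₀ (norm_nonneg u) huv 2) (hu.imp (fun h => by positivity) id))
        rw [ENNReal.toReal_add ENNReal.ofReal_ne_top (ENNReal.mul_ne_top ENNReal.ofReal_ne_top
          (ENNReal.add_ne_top.2 ⟨hPv, hNu⟩)), ENNReal.toReal_mul, ENNReal.toReal_mul,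
          ENNReal.toReal_add hPv hNu, ENNReal.toReal_add hPu hNv,
          ENNReal.toReal_ofReal hpos, ENNReal.toReal_ofReal hc.le] at h
        exact h
      rcases le_total ‖x - y‖ ‖e‖ with h | h
      · have := aux _ _ h hxy (Or.inl he0)
        rw [hen, one_pow] at this
        linarith
      · have := aux _ _ h (Or.inl he0) hxy
        rw [hen, one_pow] at this
        linarith
    have hmulP : ENNReal.ofReal c * heatInt (Set.Ioc 0 1) (x - y) =
        ENNReal.ofReal (c * (heatInt (Set.Ioc 0 1) (x - y)).toReal) := by
      rw [ENNReal.ofReal_mul hc.le, ENNReal.ofReal_toReal hP]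
    have hmulN : ENNReal.ofReal c * deficitInt (x - y) =
        ENNReal.ofReal (c * (deficitInt (x - y)).toReal) := by
      rw [ENNReal.ofReal_mul hc.le, ENNReal.ofReal_toReal hN]
    rw [hmulP, hmulN, ← EReal.coe_neg, EReal.toENNReal_of_ne_top (EReal.coe_ne_top _),
      EReal.toENNReal_of_ne_top (EReal.coe_ne_top _), EReal.toReal_coe, EReal.toReal_coe]
    exact ofReal_add_ofReal_neg_of_eq (by positivity) (by positivity) hreal
  -- On the diagonal with `d ≥ 2`, the kernel and the small-time heat integral are both infinite, so
  -- both sides are `⊤`.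
  · push Not at hxy
    have hd2 : 2 ≤ d := by omega
    rw [hxy.1, sub_eq_zero.1 hxy.1, coulombKernel_self hd2, heatInt_Ioc_zero_one_zero hd2,
      ENNReal.mul_top (by simpa using hc)]
    simp

end Coulomb

/-! ### Double integrals of kernels, Gaussian smearing, and positive definiteness -/

section KernelIntegrals

variable {d : ℕ}

/-- The double integral of a translation invariant kernel against two measures. -/
def kernelInt (k : EuclideanSpace ℝ (Fin d) → ℝ≥0∞) (α β : Measure (EuclideanSpace ℝ (Fin d))) :
    ℝ≥0∞ :=
  ∫⁻ x, ∫⁻ y, k (x - y) ∂β ∂α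

variable {k l : EuclideanSpace ℝ (Fin d) → ℝ≥0∞} {α β σ : Measure (EuclideanSpace ℝ (Fin d))}

theorem measurable_lintegral_sub (hk : Measurable k) [SFinite β] :
    Measurable fun x => ∫⁻ y, k (x - y) ∂β :=
  Measurable.lintegral_prod_right' (f := fun p : EuclideanSpace ℝ (Fin d) ×
    EuclideanSpace ℝ (Fin d) => k (p.1 - p.2)) (by fun_prop)

theorem kernelInt_add_left : kernelInt k (α + β) σ = kernelInt k α σ + kernelInt k β σ := by
  simp [kernelInt, lintegral_add_measure]

theorem kernelInt_smul_left (r : ℝ≥0∞) : kernelInt k (r • α) σ = r * kernelInt k α σ := by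
  simp [kernelInt, lintegral_smul_measure]

theorem kernelInt_comm (hk : Measurable k) (hs : ∀ x, k (-x) = k x) [SFinite α] [SFinite β] :
    kernelInt k α β = kernelInt k β α := by
  unfold kernelInt
  rw [lintegral_lintegral_swap (Measurable.aemeasurable (by fun_prop))]
  refine lintegral_congr fun y => lintegral_congr fun x => ?_
  rw [← hs, neg_sub]

theorem kernelInt_mono (h : ∀ x, k x ≤ l x) : kernelInt k α β ≤ kernelInt l α β :=
  lintegral_mono fun _ => lintegral_mono fun _ => h _

theorem kernelInt_add (hk : Measurable k) [SFinite β] :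
    kernelInt (fun x => k x + l x) α β = kernelInt k α β + kernelInt l α β := by
  unfold kernelInt
  rw [← lintegral_add_left (measurable_lintegral_sub hk)]
  refine lintegral_congr fun x => ?_
  rw [lintegral_add_left (by fun_prop)]

theorem kernelInt_const (c : ℝ≥0∞) :
    kernelInt (fun _ => c) α β = c * (β Set.univ * α Set.univ) := by
  simp [kernelInt, mul_assoc]

theorem kernelInt_const_mul (c : ℝ≥0∞) (hk : Measurable k) [SFinite β] :
    kernelInt (fun x => c * k x) α β = c * kernelInt k α β := by
  unfold kernelInt
  rw [← lintegral_const_mul _ (measurable_lintegral_sub hk)]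
  refine lintegral_congr fun x => ?_
  rw [lintegral_const_mul _ (by fun_prop)]

/-- The law of `x + √s • z` for `x` of law `α` and `z` an independent Gaussian. -/
def smear (s : ℝ) (α : Measure (EuclideanSpace ℝ (Fin d))) :
    Measure (EuclideanSpace ℝ (Fin d)) :=
  (α.prod (gaussMeasure d)).map fun p => p.1 + √s • p.2

theorem lintegral_smear (s : ℝ) [SFinite α] (hk : Measurable k) :
    ∫⁻ x, k x ∂smear s α = ∫⁻ x, ∫⁻ z, k (x + √s • z) ∂gaussMeasure d ∂α := by
  rw [smear, lintegral_map hk (by fun_prop), lintegral_prod _ (by fun_prop)]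

instance isFiniteMeasure_smear (s : ℝ) [IsFiniteMeasure α] : IsFiniteMeasure (smear s α) := by
  unfold smear; infer_instance

theorem smear_univ (s : ℝ) [IsFiniteMeasure α] : smear s α Set.univ = α Set.univ := by
  rw [smear, Measure.map_apply (by fun_prop) MeasurableSet.univ]
  simp [← Set.univ_prod_univ]

theorem kernelInt_smear_left (s : ℝ) [IsFiniteMeasure α] [SFinite σ] (hk : Measurable k) :
    kernelInt k (smear s α) σ =
      kernelInt (fun x => ∫⁻ z, k (x + √s • z) ∂gaussMeasure d) α σ := by
  unfold kernelInt
  rw [lintegral_smear s (measurable_lintegral_sub hk)]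
  refine lintegral_congr fun x => ?_
  rw [lintegral_lintegral_swap]
  · simp_rw [sub_add_eq_add_sub]
  · exact Measurable.aemeasurable (by fun_prop)

theorem lintegral_lintegral_lintegral_mul {X : Type*} [MeasurableSpace X] {a b c : Measure X}
    [SFinite a] [SFinite b] [SFinite c] {F : X → X → ℝ≥0∞}
    (hF : Measurable (Function.uncurry F)) :
    ∫⁻ x, ∫⁻ y, ∫⁻ z, F x z * F y z ∂c ∂b ∂a =
      ∫⁻ z, (∫⁻ x, F x z ∂a) * ∫⁻ y, F y z ∂b ∂c := by
  have hb : Measurable fun z => ∫⁻ y, F y z ∂b := hF.lintegral_prod_left'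
  have hx : ∀ x, Measurable (F x) := fun x => hF.comp measurable_prodMk_left
  have hz : ∀ z, Measurable fun x => F x z := fun z => hF.comp measurable_prodMk_right
  have h1 : ∀ x, ∫⁻ y, ∫⁻ z, F x z * F y z ∂c ∂b = ∫⁻ z, F x z * ∫⁻ y, F y z ∂b ∂c := by
    intro x
    rw [lintegral_lintegral_swap]
    · exact lintegral_congr fun z => lintegral_const_mul _ (hz z)
    · exact (((hx x).comp measurable_snd).mul hF).aemeasurable
  simp_rw [h1]
  rw [lintegral_lintegral_swap]
  · exact lintegral_congr fun z => lintegral_mul_const _ (hz z)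
  · exact (hF.mul (hb.comp measurable_snd)).aemeasurable

theorem lintegral_lintegral_const_mul {X : Type*} [MeasurableSpace X] {a b : Measure X}
    [SFinite b] (c : ℝ≥0∞) {F : X → X → ℝ≥0∞} (hF : Measurable (Function.uncurry F)) :
    ∫⁻ x, ∫⁻ y, c * F x y ∂b ∂a = c * ∫⁻ x, ∫⁻ y, F x y ∂b ∂a := by
  have hm : Measurable fun x => ∫⁻ y, F x y ∂b := hF.lintegral_prod_right'
  rw [← lintegral_const_mul _ hm]
  exact lintegral_congr fun x => lintegral_const_mul _ (hF.comp measurable_prodMk_left)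

/-- The heat kernel is positive definite. -/
theorem two_mul_kernelInt_heatKernel_le {t : ℝ} (ht : 0 < t) [SFinite α] [SFinite β] :
    2 * kernelInt (heatKernel t) α β ≤
      kernelInt (heatKernel t) α α + kernelInt (heatKernel t) β β := by
  set g : EuclideanSpace ℝ (Fin d) → ℝ≥0∞ :=
    fun w => ENNReal.ofReal (Real.exp (-(2 / t) * ‖w‖ ^ 2)) with hg
  have hgm : Measurable g := by fun_prop
  set c : ℝ≥0∞ := ENNReal.ofReal ((Real.pi / (4 / t)) ^ ((d : ℝ) / 2)) with hc
  set q : ℝ≥0∞ := ENNReal.ofReal (t ^ (-(d : ℝ) / 2)) with hq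
  have hc0 : c ≠ 0 := by rw [hc]; simp; positivity
  have hct : c ≠ ⊤ := ENNReal.ofReal_ne_top
  -- Up to constants, the heat kernel at time `t` is the self-convolution of the one at time `t /
  -- 2`; the parallelogram law separates `‖x - y‖²` from the distance of `z` to the midpoint. Its
  -- double integrals thus become integrals of products of potentials.
  have key : ∀ x y : EuclideanSpace ℝ (Fin d),
      c * heatKernel t (x - y) = q * ∫⁻ z, g (x - z) * g (y - z) := by
    intro x y
    have h1 : ∀ z, g (x - z) * g (y - z) = ENNReal.ofReal (Real.exp (-‖x - y‖ ^ 2 / t)) *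
        ENNReal.ofReal (Real.exp (-(4 / t) * ‖z - (2⁻¹ : ℝ) • (x + y)‖ ^ 2)) := by
      intro z
      simp only [hg]
      rw [← ENNReal.ofReal_mul (by positivity), ← ENNReal.ofReal_mul (by positivity),
        ← Real.exp_add, ← Real.exp_add]
      congr 2
      have h2 := parallelogram_law_with_norm ℝ (x - z) (y - z)
      have h3 : x - z + (y - z) = (-2 : ℝ) • (z - (2⁻¹ : ℝ) • (x + y)) := by module
      rw [h3, norm_smul, sub_sub_sub_cancel_right] at h2
      simp only [norm_neg, Real.norm_ofNat] at h2
      field_simp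
      nlinarith
    simp_rw [h1]
    rw [lintegral_const_mul _ (by fun_prop), lintegral_sub_right_eq_self
      (fun z => ENNReal.ofReal (Real.exp (-(4 / t) * ‖z‖ ^ 2))),
      lintegral_exp_neg_mul_sq_norm (by positivity), heatKernel, ENNReal.ofReal_mul (by positivity)]
    ring
  clear_value g c q
  have main : ∀ (a b : Measure (EuclideanSpace ℝ (Fin d))) [SFinite a] [SFinite b],
      c * kernelInt (heatKernel t) a b =
        q * ∫⁻ z, (∫⁻ x, g (x - z) ∂a) * ∫⁻ y, g (y - z) ∂b := by
    intro a b _ _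
    have hF : Measurable (Function.uncurry fun x z => g (x - z)) := by
      unfold Function.uncurry; fun_prop
    rw [← lintegral_lintegral_lintegral_mul hF, ← kernelInt_const_mul _ (by fun_prop)]
    unfold kernelInt
    simp_rw [key]
    refine lintegral_lintegral_const_mul q ?_
    exact Measurable.lintegral_prod_right' (f := fun p : (EuclideanSpace ℝ (Fin d) ×
        EuclideanSpace ℝ (Fin d)) × EuclideanSpace ℝ (Fin d) =>
          g (p.1.1 - p.2) * g (p.1.2 - p.2)) (by fun_prop)
  rw [← ENNReal.mul_le_mul_iff_right hc0 hct, mul_left_comm, mul_add, main, main, main,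
    mul_left_comm, ← mul_add]
  gcongr
  have hA : ∀ (a : Measure (EuclideanSpace ℝ (Fin d))) [SFinite a],
      Measurable fun z => ∫⁻ y, g (y - z) ∂a := fun a _ =>
    Measurable.lintegral_prod_right' (f := fun p : EuclideanSpace ℝ (Fin d) ×
        EuclideanSpace ℝ (Fin d) => g (p.2 - p.1)) (by fun_prop)
  have hA1 := hA α
  have hA2 := hA β
  rw [← lintegral_const_mul _ (by fun_prop), ← lintegral_add_left (by fun_prop)]
  refine lintegral_mono fun z => ?_
  generalize ∫⁻ x, g (x - z) ∂α = u
  generalize ∫⁻ x, g (x - z) ∂β = v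
  -- `2uv ≤ u² + v²` without subtraction: write the larger number as the smaller plus `w`, so that
  -- the slack is `w²`.
  rcases le_total u v with h | h
  · obtain ⟨w, rfl⟩ := exists_add_of_le h
    calc 2 * (u * (u + w)) ≤ 2 * (u * (u + w)) + w * w := le_self_add
      _ = _ := by ring
  · obtain ⟨w, rfl⟩ := exists_add_of_le h
    calc 2 * ((v + w) * v) ≤ 2 * ((v + w) * v) + w * w := le_self_add
      _ = _ := by ring

theorem kernelInt_heatInt (I : Set ℝ) [SFinite α] [SFinite β] :
    kernelInt (heatInt I) α β = ∫⁻ t in I, kernelInt (heatKernel t) α β := by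
  unfold kernelInt heatInt
  have h : ∀ x, ∫⁻ y, (∫⁻ t in I, heatKernel t (x - y)) ∂β =
      ∫⁻ t in I, ∫⁻ y, heatKernel t (x - y) ∂β := fun x =>
    lintegral_lintegral_swap (measurable_heatKernel.comp (by fun_prop :
      Measurable fun p : EuclideanSpace ℝ (Fin d) × ℝ => (p.2, x - p.1))).aemeasurable
  simp_rw [h]
  refine lintegral_lintegral_swap (Measurable.aemeasurable ?_)
  exact Measurable.lintegral_prod_right' (f := fun p : (EuclideanSpace ℝ (Fin d) × ℝ) ×
    EuclideanSpace ℝ (Fin d) => heatKernel p.1.2 (p.1.1 - p.2))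
    (measurable_heatKernel.comp (by fun_prop : Measurable fun p : (EuclideanSpace ℝ (Fin d) × ℝ) ×
      EuclideanSpace ℝ (Fin d) => (p.1.2, p.1.1 - p.2)))

theorem measurable_kernelInt_heatKernel [SFinite α] [SFinite β] :
    Measurable fun t : ℝ => kernelInt (heatKernel t) α β := by
  have h : Measurable fun p : ℝ × EuclideanSpace ℝ (Fin d) =>
      ∫⁻ y, heatKernel p.1 (p.2 - y) ∂β :=
    Measurable.lintegral_prod_right' (f := fun p : (ℝ × EuclideanSpace ℝ (Fin d)) ×
      EuclideanSpace ℝ (Fin d) => heatKernel p.1.1 (p.1.2 - p.2))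
      (measurable_heatKernel.comp (by fun_prop : Measurable fun p : (ℝ × EuclideanSpace ℝ (Fin d)) ×
        EuclideanSpace ℝ (Fin d) => (p.1.1, p.1.2 - p.2)))
  exact h.lintegral_prod_right'

theorem two_mul_kernelInt_heatInt_le [SFinite α] [SFinite β] :
    2 * kernelInt (heatInt (Set.Ioc 0 1)) α β ≤
      kernelInt (heatInt (Set.Ioc 0 1)) α α + kernelInt (heatInt (Set.Ioc 0 1)) β β := by
  simp_rw [kernelInt_heatInt]
  have hm : ∀ (a b : Measure (EuclideanSpace ℝ (Fin d))) [SFinite a] [SFinite b],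
    Measurable fun t : ℝ => kernelInt (heatKernel t) a b :=
      fun a b _ _ => measurable_kernelInt_heatKernel
  rw [← lintegral_const_mul _ (hm _ _), ← lintegral_add_left (hm _ _)]
  exact setLIntegral_mono ((hm _ _).add (hm _ _)) fun t ht => two_mul_kernelInt_heatKernel_le ht.1

end KernelIntegrals

/-! ### Finite energy and the bilinear energy in heat kernel form -/

section FiniteHeat

variable {d : ℕ}

/-- Finiteness of the energy, expressed through the heat kernel. -/
structure FiniteHeat (α : Measure (EuclideanSpace ℝ (Fin d))) : Prop where
  finite : IsFiniteMeasure α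
  heat : kernelInt (heatInt (Set.Ioc 0 1)) α α < ⊤
  deficit : ∫⁻ x, deficitInt x ∂α < ⊤

variable {α β σ : Measure (EuclideanSpace ℝ (Fin d))}

/-- Positive definiteness controls mixed energies by self-energies. This lets the energy be expanded
bilinearly. -/
theorem FiniteHeat.kernelInt_heatInt_lt_top (hα : FiniteHeat α) (hβ : FiniteHeat β) :
    kernelInt (heatInt (Set.Ioc 0 1)) α β < ⊤ := by
  have := hα.finite
  have := hβ.finite
  have h := two_mul_kernelInt_heatInt_le.trans_lt (ENNReal.add_lt_top.2 ⟨hα.heat, hβ.heat⟩)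
  exact lt_of_le_of_lt (le_mul_of_one_le_left zero_le (by norm_num)) h

theorem deficitInt_sub_le (x y : EuclideanSpace ℝ (Fin d)) :
    deficitInt (x - y) ≤ 4 * deficitInt x + 4 * deficitInt y := by
  rw [sub_eq_add_neg, ← deficitInt_neg y]
  exact deficitInt_add_le _ _

theorem FiniteHeat.kernelInt_deficitInt_lt_top (hα : FiniteHeat α) (hβ : FiniteHeat β) :
    kernelInt deficitInt α β < ⊤ := by
  have := hα.finite
  have := hβ.finite
  calc kernelInt deficitInt α β
      ≤ ∫⁻ x, ∫⁻ y, (4 * deficitInt x + 4 * deficitInt y) ∂β ∂α :=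
        lintegral_mono fun _ => lintegral_mono fun _ => deficitInt_sub_le _ _
    _ = 4 * (∫⁻ x, deficitInt x ∂α) * β Set.univ
        + 4 * (∫⁻ y, deficitInt y ∂β) * α Set.univ := by
        have : ∀ x : EuclideanSpace ℝ (Fin d),
            ∫⁻ y, (4 * deficitInt x + 4 * deficitInt y) ∂β =
              4 * deficitInt x * β Set.univ + 4 * (∫⁻ y, deficitInt y ∂β) := fun x => by
          rw [lintegral_add_left measurable_const, lintegral_const,
            lintegral_const_mul _ (by fun_prop)]
        simp_rw [this]
        rw [lintegral_add_right _ measurable_const, lintegral_const,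
          lintegral_mul_const _ (by fun_prop), lintegral_const_mul _ (by fun_prop)]
    _ < ⊤ := ENNReal.add_lt_top.2 ⟨ENNReal.mul_lt_top (ENNReal.mul_lt_top (by simp) hα.deficit)
        (measure_lt_top _ _), ENNReal.mul_lt_top (ENNReal.mul_lt_top (by simp) hβ.deficit)
        (measure_lt_top _ _)⟩

theorem FiniteHeat.add (hα : FiniteHeat α) (hβ : FiniteHeat β) : FiniteHeat (α + β) := by
  have := hα.finite
  have := hβ.finite
  refine ⟨inferInstance, ?_, ?_⟩
  · have hm := measurable_heatInt (d := d) (Set.Ioc 0 1)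
    rw [kernelInt_add_left, kernelInt_comm hm (heatInt_neg _),
      kernelInt_comm hm (heatInt_neg _) (α := β), kernelInt_add_left, kernelInt_add_left]
    exact ENNReal.add_lt_top.2 ⟨ENNReal.add_lt_top.2 ⟨hα.heat, hβ.kernelInt_heatInt_lt_top hα⟩,
      ENNReal.add_lt_top.2 ⟨hα.kernelInt_heatInt_lt_top hβ, hβ.heat⟩⟩
  · rw [lintegral_add_measure]
    exact ENNReal.add_lt_top.2 ⟨hα.deficit, hβ.deficit⟩

theorem FiniteHeat.mono (hα : FiniteHeat α) (h : β ≤ α) : FiniteHeat β := by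
  have := hα.finite
  refine ⟨isFiniteMeasure_of_le α h, ?_, (lintegral_mono' h le_rfl).trans_lt hα.deficit⟩
  exact lt_of_le_of_lt (lintegral_mono' h fun x => lintegral_mono' h le_rfl) hα.heat

theorem FiniteHeat.smul (hα : FiniteHeat α) {r : ℝ≥0∞} (hr : r ≤ 1) : FiniteHeat (r • α) := by
  refine hα.mono (Measure.le_iff.2 fun s _ => ?_)
  rw [Measure.smul_apply, smul_eq_mul]
  exact mul_le_of_le_one_left zero_le hr

/-- Averaging raises the small-time heat integral by at most `s`, so the two arguments can be
smeared one at a time, using symmetry. The deficit moment follows from the quasi-triangle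
inequality. -/
theorem FiniteHeat.smear (hd : 1 ≤ d) (hα : FiniteHeat α) {s : ℝ} (hs : 0 < s) :
    FiniteHeat (smear s α) := by
  have := hα.finite
  have hm := measurable_heatInt (d := d) (Set.Ioc 0 1)
  have hstep : ∀ (β σ : Measure (EuclideanSpace ℝ (Fin d))) [IsFiniteMeasure β]
      [IsFiniteMeasure σ], kernelInt (heatInt (Set.Ioc 0 1)) β σ < ⊤ →
      kernelInt (heatInt (Set.Ioc 0 1)) (_root_.smear s β) σ < ⊤ := by
    intro β σ _ _ h
    rw [kernelInt_smear_left s hm]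
    refine (kernelInt_mono fun x => lintegral_heatInt_add_smul_le hs x).trans_lt ?_
    rw [kernelInt_add hm, kernelInt_const]
    exact ENNReal.add_lt_top.2 ⟨h, ENNReal.mul_lt_top ENNReal.ofReal_lt_top
      (ENNReal.mul_lt_top (measure_lt_top _ _) (measure_lt_top _ _))⟩
  refine ⟨inferInstance, hstep _ _ ?_, ?_⟩
  · rw [kernelInt_comm hm (heatInt_neg _)]
    exact hstep _ _ hα.heat
  · rw [lintegral_smear s measurable_deficitInt]
    calc _ ≤ ∫⁻ x, (4 * deficitInt x +
          4 * ∫⁻ z, deficitInt (√s • z) ∂gaussMeasure d) ∂α := by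
          refine lintegral_mono fun x => ?_
          refine (lintegral_mono fun z => deficitInt_add_le x (√s • z)).trans_eq ?_
          rw [lintegral_add_left measurable_const, lintegral_const,
            lintegral_const_mul _ (by fun_prop)]
          simp
      _ < ⊤ := by
          rw [lintegral_add_right _ measurable_const, lintegral_const_mul _ (by fun_prop),
            lintegral_const]
          exact ENNReal.add_lt_top.2 ⟨ENNReal.mul_lt_top (by simp) hα.deficit,
            ENNReal.mul_lt_top (ENNReal.mul_lt_top (by simp)
              (lintegral_deficitInt_smul_lt_top hd _)) (measure_lt_top _ _)⟩

/-- The bilinear Coulomb energy, expressed through the heat kernel; the real `C` is the constant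
of `exists_coulombKernel_decomposition`. -/
def heatEnergy (C : ℝ) (α β : Measure (EuclideanSpace ℝ (Fin d))) : ℝ :=
  coulombConst d * (kernelInt (heatInt (Set.Ioc 0 1)) α β).toReal
    - coulombConst d * (kernelInt deficitInt α β).toReal
    + C * ((β Set.univ).toReal * (α Set.univ).toReal)

theorem heatEnergy_comm (C : ℝ) [SFinite α] [SFinite β] :
    heatEnergy C α β = heatEnergy C β α := by
  unfold heatEnergy
  rw [kernelInt_comm (measurable_heatInt _) (heatInt_neg _),
    kernelInt_comm measurable_deficitInt deficitInt_neg, mul_comm (β Set.univ).toReal]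

theorem FiniteHeat.heatEnergy_add_left (C : ℝ) (hα : FiniteHeat α) (hβ : FiniteHeat β)
    (hσ : FiniteHeat σ) : heatEnergy C (α + β) σ = heatEnergy C α σ + heatEnergy C β σ := by
  have := hα.finite
  have := hβ.finite
  unfold heatEnergy
  rw [kernelInt_add_left, kernelInt_add_left, Measure.add_apply,
    ENNReal.toReal_add (hα.kernelInt_heatInt_lt_top hσ).ne (hβ.kernelInt_heatInt_lt_top hσ).ne,
    ENNReal.toReal_add (hα.kernelInt_deficitInt_lt_top hσ).ne
      (hβ.kernelInt_deficitInt_lt_top hσ).ne,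
    ENNReal.toReal_add (measure_ne_top _ _) (measure_ne_top _ _)]
  ring

theorem heatEnergy_smul_left (C : ℝ) (r : ℝ≥0∞) :
    heatEnergy C (r • α) σ = r.toReal * heatEnergy C α σ := by
  unfold heatEnergy
  rw [kernelInt_smul_left, kernelInt_smul_left, Measure.smul_apply, smul_eq_mul,
    ENNReal.toReal_mul, ENNReal.toReal_mul, ENNReal.toReal_mul]
  ring

theorem FiniteHeat.heatEnergy_add_right (C : ℝ) (hα : FiniteHeat α) (hβ : FiniteHeat β)
    (hσ : FiniteHeat σ) : heatEnergy C σ (α + β) = heatEnergy C σ α + heatEnergy C σ β := by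
  have := hα.finite
  have := hβ.finite
  have := hσ.finite
  rw [heatEnergy_comm, hα.heatEnergy_add_left C hβ hσ, heatEnergy_comm, heatEnergy_comm (α := β)]

theorem heatEnergy_smul_right (C : ℝ) {r : ℝ≥0∞} [SFinite α] [SFinite σ] :
    heatEnergy C σ (r • α) = r.toReal * heatEnergy C σ α := by
  rw [heatEnergy_comm, heatEnergy_smul_left, heatEnergy_comm]

/-- The effect of a Gaussian average on the energy. -/
theorem FiniteHeat.heatEnergy_smear_left (hd : 1 ≤ d) (C : ℝ) {s : ℝ} (hs : 0 < s)
    (hα : FiniteHeat α) (hσ : FiniteHeat σ) :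
    kernelInt (heatInt (Set.Ioc 0 s)) α σ < ⊤ ∧
    heatEnergy C (_root_.smear s α) σ = heatEnergy C α σ
      - coulombConst d * (kernelInt (heatInt (Set.Ioc 0 s)) α σ).toReal
      + coulombConst d * ((heatMass d s).toReal - (heatGap d s).toReal) *
        ((σ Set.univ).toReal * (α Set.univ).toReal) := by
  have := hα.finite
  have := hσ.finite
  have hβ := hα.smear hd hs
  have hm := measurable_heatInt (d := d) (Set.Ioc 0 1)
  have hms := measurable_heatInt (d := d) (Set.Ioc 0 s)
  have hN := measurable_deficitInt (d := d)
  have hav : ∀ {k : EuclideanSpace ℝ (Fin d) → ℝ≥0∞}, Measurable k →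
      Measurable fun x => ∫⁻ z, k (x + √s • z) ∂gaussMeasure d := fun {k} hk =>
    Measurable.lintegral_prod_right' (f := fun p : EuclideanSpace ℝ (Fin d) ×
      EuclideanSpace ℝ (Fin d) => k (p.1 + √s • p.2)) (by fun_prop)
  have hm' := hav hm
  have hN' := hav hN
  have h : kernelInt (heatInt (Set.Ioc 0 1)) α σ + kernelInt deficitInt (_root_.smear s α) σ +
        heatMass d s * (σ Set.univ * α Set.univ) =
      kernelInt (heatInt (Set.Ioc 0 1)) (_root_.smear s α) σ +
        kernelInt (heatInt (Set.Ioc 0 s)) α σ + kernelInt deficitInt α σ +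
        heatGap d s * (σ Set.univ * α Set.univ) := by
    have h1 : Measurable fun x => heatInt (Set.Ioc 0 1) x +
        ∫⁻ z, deficitInt (x + √s • z) ∂gaussMeasure d := hm.add hN'
    have h2 : Measurable fun x => ∫⁻ z, heatInt (Set.Ioc 0 1) (x + √s • z) ∂gaussMeasure d +
        heatInt (Set.Ioc 0 s) x := hm'.add hms
    have h3 : Measurable fun x => ∫⁻ z, heatInt (Set.Ioc 0 1) (x + √s • z) ∂gaussMeasure d +
        heatInt (Set.Ioc 0 s) x + deficitInt x := h2.add hN
    rw [kernelInt_smear_left s hm, kernelInt_smear_left s hN, ← kernelInt_const, ← kernelInt_const,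
      ← kernelInt_add hm, ← kernelInt_add h1, ← kernelInt_add hm', ← kernelInt_add h2,
      ← kernelInt_add h3]
    simp_rw [heatInt_add_lintegral_deficitInt hs]
  have hmass : heatMass d s ≠ ⊤ := (heatMass_le.trans_lt ENNReal.ofReal_lt_top).ne
  have hgap := (heatGap_lt_top hd hs).ne
  have huu : σ Set.univ * α Set.univ ≠ ⊤ :=
    ENNReal.mul_ne_top (measure_ne_top _ _) (measure_ne_top _ _)
  have h1 := (hα.kernelInt_heatInt_lt_top hσ).ne
  have h2 := (hα.kernelInt_deficitInt_lt_top hσ).ne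
  have h3 := (hβ.kernelInt_heatInt_lt_top hσ).ne
  have h4 := (hβ.kernelInt_deficitInt_lt_top hσ).ne
  -- Since `s` may exceed 1, finiteness is read off from `h`, whose left side is finite and whose
  -- right side contains this term.
  have h5 : kernelInt (heatInt (Set.Ioc 0 s)) α σ ≠ ⊤ := by
    have hfin : kernelInt (heatInt (Set.Ioc 0 1)) α σ +
        kernelInt deficitInt (_root_.smear s α) σ + heatMass d s * (σ Set.univ * α Set.univ) ≠ ⊤ :=
      ENNReal.add_ne_top.2 ⟨ENNReal.add_ne_top.2 ⟨h1, h4⟩, ENNReal.mul_ne_top hmass huu⟩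
    rw [h] at hfin
    exact (ENNReal.add_ne_top.1 (ENNReal.add_ne_top.1 (ENNReal.add_ne_top.1 hfin).1).1).2
  refine ⟨h5.lt_top, ?_⟩
  have hr := congrArg ENNReal.toReal h
  rw [ENNReal.toReal_add (ENNReal.add_ne_top.2 ⟨h1, h4⟩) (ENNReal.mul_ne_top hmass huu),
    ENNReal.toReal_add h1 h4, ENNReal.toReal_add
      (ENNReal.add_ne_top.2 ⟨ENNReal.add_ne_top.2 ⟨h3, h5⟩, h2⟩) (ENNReal.mul_ne_top hgap huu),
    ENNReal.toReal_add (ENNReal.add_ne_top.2 ⟨h3, h5⟩) h2, ENNReal.toReal_add h3 h5,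
    ENNReal.toReal_mul, ENNReal.toReal_mul, ENNReal.toReal_mul] at hr
  simp only [ENNReal.toReal_mul] at hr
  unfold heatEnergy
  rw [smear_univ]
  linear_combination (-coulombConst d) * hr

/-- The property of the constant given by `exists_coulombKernel_decomposition`. -/
def IsCoulombShift (d : ℕ) (C : ℝ) : Prop :=
  ∀ x y : EuclideanSpace ℝ (Fin d),
    (coulombKernel d x y).toENNReal +
        ENNReal.ofReal (coulombConst d) * deficitInt (x - y) + ENNReal.ofReal (-C) =
      (-coulombKernel d x y).toENNReal +
        ENNReal.ofReal (coulombConst d) * heatInt (Set.Ioc 0 1) (x - y) + ENNReal.ofReal C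

theorem toENNReal_eq_zero_or (a : EReal) : a.toENNReal = 0 ∨ (-a).toENNReal = 0 := by
  rcases le_total a 0 with h | h
  · exact Or.inl (EReal.toENNReal_of_nonpos h)
  · exact Or.inr (EReal.toENNReal_of_nonpos (by simpa using h))

/-- At each pair of points the positive or the negative part of the kernel vanishes; in the
remaining case the identity gives the bound directly. -/
theorem IsCoulombShift.pos_le {C : ℝ} (hC : IsCoulombShift d C)
    (x y : EuclideanSpace ℝ (Fin d)) :
    (coulombKernel d x y).toENNReal ≤
      ENNReal.ofReal (coulombConst d) * heatInt (Set.Ioc 0 1) (x - y) + ENNReal.ofReal C := by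
  rcases toENNReal_eq_zero_or (coulombKernel d x y) with h | h
  · rw [h]; exact zero_le
  · have := hC x y
    rw [h, zero_add, add_assoc] at this
    exact this ▸ le_self_add

theorem IsCoulombShift.neg_le {C : ℝ} (hC : IsCoulombShift d C)
    (x y : EuclideanSpace ℝ (Fin d)) :
    (-coulombKernel d x y).toENNReal ≤
      ENNReal.ofReal (coulombConst d) * deficitInt (x - y) + ENNReal.ofReal (-C) := by
  rcases toENNReal_eq_zero_or (coulombKernel d x y) with h | h
  · have := hC x y
    rw [h, zero_add, add_assoc] at this
    exact this ▸ le_self_add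
  · rw [h]; exact zero_le

theorem FiniteHeat.energy_lt_top {C : ℝ} (hC : IsCoulombShift d C) (hα : FiniteHeat α)
    (hβ : FiniteHeat β) :
    energyPos (coulombKernel d) α β < ⊤ ∧ energyNeg (coulombKernel d) α β < ⊤ := by
  have := hα.finite
  have := hβ.finite
  have hm := measurable_heatInt (d := d) (Set.Ioc 0 1)
  have hN := measurable_deficitInt (d := d)
  have huu : ∀ c : ℝ, ENNReal.ofReal c * (β Set.univ * α Set.univ) < ⊤ := fun c =>
    ENNReal.mul_lt_top ENNReal.ofReal_lt_top
      (ENNReal.mul_lt_top (measure_lt_top _ _) (measure_lt_top _ _))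
  constructor
  · calc energyPos (coulombKernel d) α β ≤ kernelInt (fun x => ENNReal.ofReal (coulombConst d) *
          heatInt (Set.Ioc 0 1) x + ENNReal.ofReal C) α β :=
          lintegral_mono fun x => lintegral_mono fun y => hC.pos_le x y
      _ < ⊤ := by
          rw [kernelInt_add (hm.const_mul _), kernelInt_const_mul _ hm, kernelInt_const]
          exact ENNReal.add_lt_top.2 ⟨ENNReal.mul_lt_top ENNReal.ofReal_lt_top
            (hα.kernelInt_heatInt_lt_top hβ), huu _⟩
  · calc energyNeg (coulombKernel d) α β ≤ kernelInt (fun x => ENNReal.ofReal (coulombConst d) *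
          deficitInt x + ENNReal.ofReal (-C)) α β :=
          lintegral_mono fun x => lintegral_mono fun y => hC.neg_le x y
      _ < ⊤ := by
          rw [kernelInt_add (hN.const_mul _), kernelInt_const_mul _ hN, kernelInt_const]
          exact ENNReal.add_lt_top.2 ⟨ENNReal.mul_lt_top ENNReal.ofReal_lt_top
            (hα.kernelInt_deficitInt_lt_top hβ), huu _⟩

theorem lintegral_lintegral_add_right {X : Type*} [MeasurableSpace X] {a b : Measure X} [SFinite b]
    (f : X → X → ℝ≥0∞) {g : X → X → ℝ≥0∞} (hg : Measurable (Function.uncurry g)) :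
    ∫⁻ x, ∫⁻ y, (f x y + g x y) ∂b ∂a = ∫⁻ x, ∫⁻ y, f x y ∂b ∂a + ∫⁻ x, ∫⁻ y, g x y ∂b ∂a := by
  have hm : Measurable fun x => ∫⁻ y, g x y ∂b := hg.lintegral_prod_right'
  rw [← lintegral_add_right _ hm]
  exact lintegral_congr fun x => lintegral_add_right _ (hg.comp measurable_prodMk_left)

/-- Integrate the additive kernel identity; every term is then finite, so it can be rearranged over
the reals. -/
theorem FiniteHeat.mutualEnergy_eq {C : ℝ} (hd : 1 ≤ d) (hC : IsCoulombShift d C)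
    (hα : FiniteHeat α) (hβ : FiniteHeat β) :
    mutualEnergy (coulombKernel d) α β = (heatEnergy C α β : EReal) := by
  have := hα.finite
  have := hβ.finite
  have hm := measurable_heatInt (d := d) (Set.Ioc 0 1)
  have hN := measurable_deficitInt (d := d)
  obtain ⟨hp, hn⟩ := hα.energy_lt_top hC hβ
  have hc := (coulombConst_pos hd).le
  have expand : ∀ (c : ℝ) (f : EuclideanSpace ℝ (Fin d) → EuclideanSpace ℝ (Fin d) → ℝ≥0∞)
      {k : EuclideanSpace ℝ (Fin d) → ℝ≥0∞}, Measurable k →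
      ∫⁻ x, ∫⁻ y, (f x y + ENNReal.ofReal (coulombConst d) * k (x - y) + ENNReal.ofReal c) ∂β ∂α =
        ∫⁻ x, ∫⁻ y, f x y ∂β ∂α + ENNReal.ofReal (coulombConst d) * kernelInt k α β +
          ENNReal.ofReal c * (β Set.univ * α Set.univ) := by
    intro c f k hk
    rw [← kernelInt_const, ← kernelInt_const_mul _ hk, kernelInt, kernelInt,
      ← lintegral_lintegral_add_right, ← lintegral_lintegral_add_right]
    · exact measurable_const
    · unfold Function.uncurry; fun_prop
  have h : energyPos (coulombKernel d) α β +
        ENNReal.ofReal (coulombConst d) * kernelInt deficitInt α β +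
        ENNReal.ofReal (-C) * (β Set.univ * α Set.univ) =
      energyNeg (coulombKernel d) α β +
        ENNReal.ofReal (coulombConst d) * kernelInt (heatInt (Set.Ioc 0 1)) α β +
        ENNReal.ofReal C * (β Set.univ * α Set.univ) := by
    unfold energyPos energyNeg
    rw [← expand (-C) _ hN, ← expand C _ hm]
    exact lintegral_congr fun x => lintegral_congr fun y => hC x y
  have huu : ∀ c : ℝ, ENNReal.ofReal c * (β Set.univ * α Set.univ) ≠ ⊤ := fun c =>
    ENNReal.mul_ne_top ENNReal.ofReal_ne_top
      (ENNReal.mul_ne_top (measure_ne_top _ _) (measure_ne_top _ _))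
  have h1 : ENNReal.ofReal (coulombConst d) * kernelInt (heatInt (Set.Ioc 0 1)) α β ≠ ⊤ :=
    ENNReal.mul_ne_top ENNReal.ofReal_ne_top (hα.kernelInt_heatInt_lt_top hβ).ne
  have h2 : ENNReal.ofReal (coulombConst d) * kernelInt deficitInt α β ≠ ⊤ :=
    ENNReal.mul_ne_top ENNReal.ofReal_ne_top (hα.kernelInt_deficitInt_lt_top hβ).ne
  have hr := congrArg ENNReal.toReal h
  rw [ENNReal.toReal_add (ENNReal.add_ne_top.2 ⟨hp.ne, h2⟩) (huu _), ENNReal.toReal_add hp.ne h2,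
    ENNReal.toReal_add (ENNReal.add_ne_top.2 ⟨hn.ne, h1⟩) (huu _), ENNReal.toReal_add hn.ne h1] at hr
  simp only [ENNReal.toReal_mul, ENNReal.toReal_ofReal hc, ENNReal.toReal_ofReal'] at hr
  have hCC : max C 0 - max (-C) 0 = C := by
    rcases le_total 0 C with h | h
    · rw [max_eq_left h, max_eq_right (by linarith)]; ring
    · rw [max_eq_right h, max_eq_left (by linarith)]; ring
  unfold mutualEnergy
  rw [← ENNReal.ofReal_toReal hp.ne, ← ENNReal.ofReal_toReal hn.ne, EReal.coe_ennreal_ofReal,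
    EReal.coe_ennreal_ofReal, max_eq_left ENNReal.toReal_nonneg, max_eq_left ENNReal.toReal_nonneg,
    ← EReal.coe_sub]
  congr 1
  unfold heatEnergy
  linear_combination hr + ((β Set.univ).toReal * (α Set.univ).toReal) * hCC

/-- At distance at most 1 the deficit is bounded, and beyond distance 1 the heat integral is
bounded. So each of the two is dominated by the matching part of the Coulomb kernel plus a constant.
-/
theorem IsCoulombShift.finiteHeat {C : ℝ} (hd : 1 ≤ d) (hC : IsCoulombShift d C)
    [IsProbabilityMeasure α] (hα : HasFiniteEnergy (coulombKernel d) α) : FiniteHeat α := by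
  set e : EuclideanSpace ℝ (Fin d) := EuclideanSpace.single ⟨0, hd⟩ 1 with he
  have hen : ‖e‖ = 1 := by simp [he]
  have he0 : e ≠ 0 := by rw [← norm_ne_zero_iff, hen]; exact one_ne_zero
  have hPe := heatInt_Ioc_zero_one_lt_top hd (Or.inl he0)
  have hNe := deficitInt_lt_top hd e
  have hm := measurable_heatInt (d := d) (Set.Ioc 0 1)
  have hN := measurable_deficitInt (d := d)
  have hc := coulombConst_pos hd
  set c := ENNReal.ofReal (coulombConst d) with hcdef
  have hc0 : c ≠ 0 := by simpa [hcdef] using hc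
  have hct : c ≠ ⊤ := ENNReal.ofReal_ne_top
  set K : ℝ≥0∞ := c * heatInt (Set.Ioc 0 1) e + c * deficitInt e + ENNReal.ofReal C +
    ENNReal.ofReal (-C) with hK
  have hKt : K ≠ ⊤ := by
    simp [hK, ENNReal.mul_ne_top, hct, hPe.ne, hNe.ne]
  have hP1 : ∀ x y, c * heatInt (Set.Ioc 0 1) (x - y) ≤ (coulombKernel d x y).toENNReal + K := by
    intro x y
    rcases le_total ‖x - y‖ ‖e‖ with h | h
    · calc c * heatInt (Set.Ioc 0 1) (x - y)
          ≤ (-coulombKernel d x y).toENNReal + c * heatInt (Set.Ioc 0 1) (x - y)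
            + ENNReal.ofReal C := le_add_right le_add_self
        _ = (coulombKernel d x y).toENNReal + c * deficitInt (x - y) + ENNReal.ofReal (-C) :=
            (hC x y).symm
        _ ≤ (coulombKernel d x y).toENNReal + c * deficitInt e + ENNReal.ofReal (-C) := by
            gcongr; exact deficitInt_le_of_norm_le h
        _ ≤ (coulombKernel d x y).toENNReal + c * deficitInt e + ENNReal.ofReal (-C) +
            (c * heatInt (Set.Ioc 0 1) e + ENNReal.ofReal C) := le_self_add
        _ = _ := by rw [hK]; ring
    · calc c * heatInt (Set.Ioc 0 1) (x - y) ≤ c * heatInt (Set.Ioc 0 1) e := by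
            gcongr; exact heatInt_le_of_norm_le h
        _ ≤ c * heatInt (Set.Ioc 0 1) e + ((coulombKernel d x y).toENNReal + c * deficitInt e +
            ENNReal.ofReal C + ENNReal.ofReal (-C)) := le_self_add
        _ = _ := by rw [hK]; ring
  have hN1 : ∀ x y, c * deficitInt (x - y) ≤ (-coulombKernel d x y).toENNReal + K := by
    intro x y
    rcases le_total ‖x - y‖ ‖e‖ with h | h
    · calc c * deficitInt (x - y) ≤ c * deficitInt e := by
            gcongr; exact deficitInt_le_of_norm_le h
        _ ≤ c * deficitInt e + ((-coulombKernel d x y).toENNReal +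
            c * heatInt (Set.Ioc 0 1) e + ENNReal.ofReal C + ENNReal.ofReal (-C)) := le_self_add
        _ = _ := by rw [hK]; ring
    · calc c * deficitInt (x - y)
          ≤ (coulombKernel d x y).toENNReal + c * deficitInt (x - y)
            + ENNReal.ofReal (-C) := le_add_right le_add_self
        _ = (-coulombKernel d x y).toENNReal + c * heatInt (Set.Ioc 0 1) (x - y)
            + ENNReal.ofReal C := hC x y
        _ ≤ (-coulombKernel d x y).toENNReal + c * heatInt (Set.Ioc 0 1) e
            + ENNReal.ofReal C := by gcongr; exact heatInt_le_of_norm_le h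
        _ ≤ (-coulombKernel d x y).toENNReal + c * heatInt (Set.Ioc 0 1) e
            + ENNReal.ofReal C + (c * deficitInt e + ENNReal.ofReal (-C)) := le_self_add
        _ = _ := by rw [hK]; ring
  have bound : ∀ {k : EuclideanSpace ℝ (Fin d) → ℝ≥0∞}
      (f : EuclideanSpace ℝ (Fin d) → EuclideanSpace ℝ (Fin d) → ℝ≥0∞), Measurable k →
      ∫⁻ x, ∫⁻ y, f x y ∂α ∂α < ⊤ → (∀ x y, c * k (x - y) ≤ f x y + K) →
      kernelInt k α α < ⊤ := by
    intro k f hk hf h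
    have h1 : c * kernelInt k α α < ⊤ := by
      rw [← kernelInt_const_mul _ hk]
      refine (lintegral_mono fun x => lintegral_mono fun y => h x y).trans_lt ?_
      rw [lintegral_lintegral_add_right _ (g := fun _ _ => K) measurable_const]
      simpa using ⟨hf, hKt.lt_top⟩
    exact (ENNReal.mul_lt_top_iff.1 h1).elim (fun h => h.2) fun h =>
      h.elim (fun h => absurd h hc0) fun h => by rw [h]; simp
  refine ⟨inferInstance, bound _ hm hα.1 hP1, ?_⟩
  have hN2 : kernelInt deficitInt α α < ⊤ := bound _ hN hα.2 hN1
  -- Recentring: finiteness of the double integral gives a base point `x` with finite deficit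
  -- moment, and the quasi-triangle inequality moves it to the origin.
  obtain ⟨x, hx⟩ := (ae_lt_top (measurable_lintegral_sub hN) hN2.ne).exists
  calc ∫⁻ y, deficitInt y ∂α ≤ ∫⁻ y, (4 * deficitInt x + 4 * deficitInt (x - y)) ∂α := by
        refine lintegral_mono fun y => ?_
        have := deficitInt_sub_le x (x - y)
        rwa [sub_sub_cancel] at this
    _ < ⊤ := by
        rw [lintegral_add_left measurable_const, lintegral_const, measure_univ, mul_one,
          lintegral_const_mul _ (by fun_prop)]
        exact ENNReal.add_lt_top.2 ⟨ENNReal.mul_lt_top (by simp) (deficitInt_lt_top hd x),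
          ENNReal.mul_lt_top (by simp) hx⟩

theorem mmdEnergy_eq {C : ℝ} (hd : 1 ≤ d) (hC : IsCoulombShift d C)
    {ρ ν : ProbabilityMeasure (EuclideanSpace ℝ (Fin d))}
    (hρ : FiniteHeat (ρ : Measure (EuclideanSpace ℝ (Fin d))))
    (hν : FiniteHeat (ν : Measure (EuclideanSpace ℝ (Fin d)))) :
    mmdEnergy (coulombKernel d) ν ρ =
      ((heatEnergy C (ρ : Measure (EuclideanSpace ℝ (Fin d))) ρ / 2
        - heatEnergy C (ρ : Measure (EuclideanSpace ℝ (Fin d))) ν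
        + heatEnergy C (ν : Measure (EuclideanSpace ℝ (Fin d))) ν / 2 : ℝ) : EReal) := by
  have hfin : HasFiniteEnergy (coulombKernel d) (ρ : Measure (EuclideanSpace ℝ (Fin d))) :=
    hρ.energy_lt_top hC hρ
  rw [mmdEnergy, if_pos hfin, hρ.mutualEnergy_eq hd hC hρ,
    hρ.mutualEnergy_eq hd hC hν, hν.mutualEnergy_eq hd hC hν]
  rw [EReal.coe_add, EReal.coe_sub, EReal.coe_div, EReal.coe_div]
  rfl

end FiniteHeat

/-! ### From ball growth to lower bounds on heat potentials -/

section Density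

variable {d : ℕ}

theorem setLIntegral_exp_neg_Ioi (a : ℝ) :
    ∫⁻ u in Set.Ioi a, ENNReal.ofReal (Real.exp (-u)) = ENNReal.ofReal (Real.exp (-a)) := by
  rw [← ofReal_integral_eq_lintegral_ofReal (integrableOn_exp_neg_Ioi a)
    (ae_of_all _ fun _ => (Real.exp_pos _).le), integral_exp_neg_Ioi]

theorem mem_closedBall_sqrt_iff {t u : ℝ} (ht : 0 < t) (hu : 0 < u)
    (x y : EuclideanSpace ℝ (Fin d)) :
    y ∈ Metric.closedBall x √(u * t) ↔ ‖x - y‖ ^ 2 / t ≤ u := by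
  rw [Metric.mem_closedBall, dist_comm, dist_eq_norm, div_le_iff₀ ht]
  rw [← Real.sqrt_sq (norm_nonneg (x - y)), Real.sqrt_le_sqrt_iff (by positivity),
    Real.sqrt_sq (norm_nonneg _)]

/-- Layer cake formula for the heat kernel. -/
theorem lintegral_heatKernel_eq_closedBall {t : ℝ} (ht : 0 < t)
    (σ : Measure (EuclideanSpace ℝ (Fin d))) [SFinite σ] (x : EuclideanSpace ℝ (Fin d)) :
    ∫⁻ y, heatKernel t (x - y) ∂σ = ∫⁻ u in Set.Ioi (0 : ℝ),
      ENNReal.ofReal (t ^ (-(d : ℝ) / 2) * Real.exp (-u)) *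
        σ (Metric.closedBall x √(u * t)) := by
  have h1 : ∀ y, heatKernel t (x - y) = ∫⁻ u in Set.Ioi (0 : ℝ),
      (Set.Ici (‖x - y‖ ^ 2 / t)).indicator
        (fun u => ENNReal.ofReal (t ^ (-(d : ℝ) / 2) * Real.exp (-u))) u := by
    intro y
    have h0 : 0 ≤ ‖x - y‖ ^ 2 / t := by positivity
    rw [setLIntegral_indicator measurableSet_Ici, setLIntegral_congr
      (t := Set.Ioi (‖x - y‖ ^ 2 / t))]
    · simp_rw [ENNReal.ofReal_mul (show 0 ≤ t ^ (-(d : ℝ) / 2) by positivity)]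
      rw [lintegral_const_mul _ (by fun_prop), setLIntegral_exp_neg_Ioi, heatKernel,
        ENNReal.ofReal_mul (by positivity), neg_div _ (‖x - y‖ ^ 2)]
    · refine (Filter.EventuallyEq.inter (Ioi_ae_eq_Ici (a := ‖x - y‖ ^ 2 / t)).symm
        (ae_eq_refl (Set.Ioi (0 : ℝ)))).trans ?_
      rw [Set.Ioi_inter_Ioi, sup_of_le_left h0]
      exact ae_eq_refl _
  simp_rw [h1]
  rw [lintegral_lintegral_swap]
  · refine setLIntegral_congr_fun measurableSet_Ioi fun u hu => ?_
    have h2 : ∀ y, (Set.Ici (‖x - y‖ ^ 2 / t)).indicator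
        (fun u => ENNReal.ofReal (t ^ (-(d : ℝ) / 2) * Real.exp (-u))) u =
        (Metric.closedBall x √(u * t)).indicator
          (fun _ => ENNReal.ofReal (t ^ (-(d : ℝ) / 2) * Real.exp (-u))) y := by
      intro y
      simp only [Set.indicator, Set.mem_Ici, mem_closedBall_sqrt_iff ht hu]
    simp_rw [h2]
    rw [lintegral_indicator Metric.isClosed_closedBall.measurableSet]
    simp
  · refine Measurable.aemeasurable ?_
    have : MeasurableSet {p : EuclideanSpace ℝ (Fin d) × ℝ | ‖x - p.1‖ ^ 2 / t ≤ p.2} :=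
      measurableSet_le (by fun_prop) (by fun_prop)
    exact (show Measurable fun p : EuclideanSpace ℝ (Fin d) × ℝ =>
      ENNReal.ofReal (t ^ (-(d : ℝ) / 2) * Real.exp (-p.2)) by fun_prop).indicator this

/-- A positive dimensional constant. -/
def ballHeat (d : ℕ) : ℝ≥0∞ :=
  ∫⁻ u in Set.Ioc (0 : ℝ) 1, ENNReal.ofReal (Real.exp (-u) * √u ^ d)

theorem ballHeat_pos : 0 < ballHeat d := by
  unfold ballHeat
  rw [setLIntegral_pos_iff (by fun_prop)]
  have : Set.Ioc (0 : ℝ) 1 ⊆ (Function.support fun u : ℝ =>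
      ENNReal.ofReal (Real.exp (-u) * √u ^ d)) ∩ Set.Ioc 0 1 := by
    refine fun u hu => ⟨?_, hu⟩
    have h0 : 0 < u := hu.1
    simp only [Function.mem_support, ne_eq, ENNReal.ofReal_eq_zero, not_le]
    positivity
  exact lt_of_lt_of_le (by simp) (measure_mono this)

theorem ballHeat_lt_top : ballHeat d < ⊤ := by
  calc ballHeat d ≤ ∫⁻ u in Set.Ioc (0 : ℝ) 1, 1 := by
        refine setLIntegral_mono measurable_const fun u hu => ?_
        rw [← ENNReal.ofReal_one]
        refine ENNReal.ofReal_le_ofReal (mul_le_one₀ ?_ (by positivity) ?_)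
        · simpa using hu.1.le
        · exact pow_le_one₀ (Real.sqrt_nonneg _) (Real.sqrt_le_one.2 hu.2)
    _ < ⊤ := by simp

/-- Apply the layer cake formula to both potentials. Radii up to `r₁` are compared by hypothesis,
and larger ones cost at most the Gaussian tail since `σ₁` has mass at most 1. The gain `K r ^ d` is
kept only for `u ≤ 1`, which `t ≤ r₁ ^ 2` places in the controlled range; it integrates to a
quantity independent of `t` because `t ^ (-d/2) √t ^ d = 1`. -/
theorem lintegral_heatKernel_add_le_of_ball {σ₁ σ₂ : Measure (EuclideanSpace ℝ (Fin d))}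
    [IsFiniteMeasure σ₁] [IsFiniteMeasure σ₂] (h1 : σ₁ Set.univ ≤ 1)
    {x : EuclideanSpace ℝ (Fin d)} {K r₁ t : ℝ} (hK : 0 ≤ K) (hr₁ : 0 < r₁) (ht : 0 < t)
    (htr : t ≤ r₁ ^ 2)
    (h : ∀ r : ℝ, 0 < r → r ≤ r₁ → σ₁ (Metric.closedBall x r) + ENNReal.ofReal (K * r ^ d) ≤
      σ₂ (Metric.closedBall x r)) :
    ∫⁻ y, heatKernel t (x - y) ∂σ₁ + ENNReal.ofReal K * ballHeat d ≤
      ∫⁻ y, heatKernel t (x - y) ∂σ₂ +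
        ENNReal.ofReal (t ^ (-(d : ℝ) / 2) * Real.exp (-(r₁ ^ 2 / t))) := by
  have hmeas : ∀ (σ : Measure (EuclideanSpace ℝ (Fin d))), Measurable fun u : ℝ =>
      ENNReal.ofReal (t ^ (-(d : ℝ) / 2) * Real.exp (-u)) * σ (Metric.closedBall x √(u * t)) := by
    intro σ
    have : Monotone fun u : ℝ => σ (Metric.closedBall x √(u * t)) := fun u v huv =>
      measure_mono (Metric.closedBall_subset_closedBall (Real.sqrt_le_sqrt (by gcongr)))
    exact Measurable.mul (by fun_prop) this.measurable
  have hK1 : ENNReal.ofReal K * ballHeat d = ∫⁻ u in Set.Ioi (0 : ℝ),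
      (Set.Iic (1 : ℝ)).indicator (fun u => ENNReal.ofReal (t ^ (-(d : ℝ) / 2) * Real.exp (-u)) *
        ENNReal.ofReal (K * √(u * t) ^ d)) u := by
    rw [setLIntegral_indicator measurableSet_Iic, Set.inter_comm, Set.Ioi_inter_Iic, ballHeat,
      ← lintegral_const_mul _ (by fun_prop)]
    refine setLIntegral_congr_fun measurableSet_Ioc fun u hu => ?_
    have hu0 : 0 < u := hu.1
    rw [← ENNReal.ofReal_mul hK, ← ENNReal.ofReal_mul (by positivity)]
    congr 1
    rw [Real.sqrt_mul hu0.le, mul_pow]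
    have : t ^ (-(d : ℝ) / 2) * √t ^ d = 1 := by
      rw [Real.sqrt_eq_rpow, ← Real.rpow_natCast, ← Real.rpow_mul ht.le, ← Real.rpow_add ht]
      ring_nf
      simp
    linear_combination (-(K * (Real.exp (-u) * √u ^ d))) * this
  have hR : ENNReal.ofReal (t ^ (-(d : ℝ) / 2) * Real.exp (-(r₁ ^ 2 / t))) =
      ∫⁻ u in Set.Ioi (0 : ℝ), (Set.Ioi (r₁ ^ 2 / t)).indicator
        (fun u => ENNReal.ofReal (t ^ (-(d : ℝ) / 2) * Real.exp (-u))) u := by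
    rw [setLIntegral_indicator measurableSet_Ioi, Set.Ioi_inter_Ioi,
      sup_of_le_left (by positivity)]
    simp_rw [ENNReal.ofReal_mul (show 0 ≤ t ^ (-(d : ℝ) / 2) by positivity)]
    rw [lintegral_const_mul _ (by fun_prop), setLIntegral_exp_neg_Ioi]
  rw [lintegral_heatKernel_eq_closedBall ht, lintegral_heatKernel_eq_closedBall ht, hK1, hR,
    ← lintegral_add_left (hmeas σ₁), ← lintegral_add_left (hmeas σ₂)]
  refine setLIntegral_mono ((hmeas σ₂).add (Measurable.indicator (by fun_prop)
    measurableSet_Ioi)) fun u hu => ?_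
  have hu0 : 0 < u := hu
  rcases le_or_gt u (r₁ ^ 2 / t) with hur | hur
  · have hle : √(u * t) ≤ r₁ := by
      rw [Real.sqrt_le_left hr₁.le]; exact (le_div_iff₀ ht).1 hur
    have := h _ (Real.sqrt_pos.2 (mul_pos hu0 ht)) hle
    calc _ ≤ ENNReal.ofReal (t ^ (-(d : ℝ) / 2) * Real.exp (-u)) *
          σ₁ (Metric.closedBall x √(u * t)) +
          ENNReal.ofReal (t ^ (-(d : ℝ) / 2) * Real.exp (-u)) *
            ENNReal.ofReal (K * √(u * t) ^ d) := by
          gcongr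
          exact Set.indicator_le_self _ _ _
      _ ≤ _ := by
          rw [← mul_add]
          exact le_add_right (by gcongr)
  · have h1u : 1 < u := lt_of_le_of_lt ((one_le_div ht).2 htr) hur
    rw [Set.indicator_of_notMem (by simpa using h1u), Set.indicator_of_mem (by exact hur),
      add_zero]
    refine le_add_left (mul_le_of_le_one_right zero_le ?_)
    exact (measure_mono (Set.subset_univ _)).trans h1

theorem eventually_heat_tail_le_one {r : ℝ} (hr : 0 < r) :
    ∀ᶠ t in 𝓝[>] (0 : ℝ), t ^ (-(d : ℝ) / 2) * Real.exp (-(r ^ 2 / t)) ≤ 1 := by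
  have h := (tendsto_rpow_mul_exp_neg_mul_atTop_nhds_zero ((d : ℝ) / 2) (r ^ 2)
    (by positivity)).comp tendsto_inv_nhdsGT_zero
  filter_upwards [h.eventually (ge_mem_nhds zero_lt_one), self_mem_nhdsWithin] with t ht ht0
  have ht0 : 0 < t := ht0
  refine le_trans (le_of_eq ?_) ht
  simp only [Function.comp]
  rw [Real.inv_rpow ht0.le, ← Real.rpow_neg ht0.le, neg_div, div_eq_mul_inv (r ^ 2), neg_mul]

/-- By singularity, `σ₁(B) / σ₂(B) → 0` at `σ₂`-almost every centre. Half of `σ₂(B)` then absorbs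
`σ₁(B)` and the other half absorbs `K r ^ d`, whence the `2 * K` in the hypothesis. Countable
exhaustion makes the radius threshold uniform on a set of positive measure. -/
theorem exists_set_closedBall_le {σ₁ σ₂ : Measure (EuclideanSpace ℝ (Fin d))}
    [IsFiniteMeasure σ₁] [IsFiniteMeasure σ₂] (hs : σ₁ ⟂ₘ σ₂)
    {S : Set (EuclideanSpace ℝ (Fin d))} (hS : MeasurableSet S) (hS0 : 0 < σ₂ S) {K : ℝ}
    (hK : 0 ≤ K)
    (h : ∀ᵐ x ∂σ₂.restrict S, ∀ᶠ r in 𝓝[>] (0 : ℝ),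
      ENNReal.ofReal (2 * K * r ^ d) ≤ σ₂ (Metric.closedBall x r)) :
    ∃ T, MeasurableSet T ∧ 0 < σ₂ T ∧ ∃ r₁ : ℝ, 0 < r₁ ∧ ∀ x ∈ T, ∀ r : ℝ, 0 < r → r ≤ r₁ →
      σ₁ (Metric.closedBall x r) + ENNReal.ofReal (K * r ^ d) ≤ σ₂ (Metric.closedBall x r) := by
  have hbes : ∀ᵐ x ∂σ₂.restrict S, Tendsto
      (fun r => σ₁ (Metric.closedBall x r) / σ₂ (Metric.closedBall x r)) (𝓝[>] 0) (𝓝 0) := by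
    refine ae_restrict_of_ae ?_
    filter_upwards [Besicovitch.ae_tendsto_rnDeriv σ₁ σ₂, hs.rnDeriv_ae_eq_zero] with x hx hx0
    rwa [hx0] at hx
  have hev : ∀ᵐ x ∂σ₂.restrict S, ∀ᶠ r in 𝓝[>] (0 : ℝ),
      σ₁ (Metric.closedBall x r) + ENNReal.ofReal (K * r ^ d) ≤ σ₂ (Metric.closedBall x r) := by
    filter_upwards [h, hbes] with x hx hx'
    filter_upwards [hx, hx'.eventually (ge_mem_nhds (show (0 : ℝ≥0∞) < 2⁻¹ by simp)),
      self_mem_nhdsWithin] with r h1 h2 hr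
    have hr : 0 < r := hr
    rw [ENNReal.div_le_iff_le_mul (Or.inr (by simp)) (Or.inl (measure_ne_top _ _))] at h2
    have h3 : ENNReal.ofReal (K * r ^ d) ≤ 2⁻¹ * σ₂ (Metric.closedBall x r) := by
      calc ENNReal.ofReal (K * r ^ d) = 2⁻¹ * ENNReal.ofReal (2 * K * r ^ d) := by
            rw [mul_assoc, ENNReal.ofReal_mul zero_le_two, ← mul_assoc]
            simp [ENNReal.inv_mul_cancel]
        _ ≤ _ := by gcongr
    calc _ ≤ 2⁻¹ * σ₂ (Metric.closedBall x r) + 2⁻¹ * σ₂ (Metric.closedBall x r) :=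
          add_le_add h2 h3
      _ = _ := by rw [← add_mul, ENNReal.inv_two_add_inv_two, one_mul]
  have hball : ∀ (σ : Measure (EuclideanSpace ℝ (Fin d))) [IsFiniteMeasure σ] (r : ℝ),
      Measurable fun x => σ (Metric.closedBall x r) := by
    intro σ _ r
    have hms : MeasurableSet {p : EuclideanSpace ℝ (Fin d) × EuclideanSpace ℝ (Fin d) |
        dist p.2 p.1 ≤ r} := measurableSet_le (by fun_prop) measurable_const
    exact measurable_measure_prodMk_left hms
  -- Imposing the inequality at rational radii only keeps these sets measurable.
  set T : ℕ → Set (EuclideanSpace ℝ (Fin d)) := fun n =>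
    S ∩ ⋂ q : ℚ, {x | 0 < (q : ℝ) → (q : ℝ) ≤ 1 / ((n : ℝ) + 1) →
      σ₁ (Metric.closedBall x q) + ENNReal.ofReal (K * (q : ℝ) ^ d) ≤
        σ₂ (Metric.closedBall x q)} with hT
  have hTm : ∀ n, MeasurableSet (T n) := by
    intro n
    refine hS.inter (MeasurableSet.iInter fun q => ?_)
    by_cases h1 : 0 < (q : ℝ) ∧ (q : ℝ) ≤ 1 / ((n : ℝ) + 1)
    · simp only [h1.1, h1.2, forall_const]
      exact measurableSet_le ((hball σ₁ q).add_const _) (hball σ₂ q)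
    · convert MeasurableSet.univ
      ext x
      simp only [Set.mem_ofPred_eq, Set.mem_univ, iff_true]
      exact fun h2 h3 => absurd ⟨h2, h3⟩ h1
  have hpos : σ₂ (⋃ n, T n) ≠ 0 := by
    have hsub : ∀ᵐ x ∂σ₂, x ∈ S → x ∈ ⋃ n, T n := by
      filter_upwards [(ae_restrict_iff' hS).1 hev] with x hx hxS
      obtain ⟨ε, hε, hlt⟩ := mem_nhdsGT_iff_exists_Ioo_subset.1 (hx hxS)
      have hε : 0 < ε := hε
      obtain ⟨n, hn⟩ := exists_nat_one_div_lt hε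
      exact Set.mem_iUnion.2 ⟨n, hxS, Set.mem_iInter.2 fun q hq hqn => hlt ⟨hq, hqn.trans_lt hn⟩⟩
    exact (hS0.trans_le (measure_mono_ae hsub)).ne'
  obtain ⟨n, hn⟩ := exists_measure_pos_of_not_measure_iUnion_null hpos
  -- The threshold `1 / (n + 2)` lies strictly below `1 / (n + 1)`, leaving room for rational radii
  -- above `r`; continuity from above then recovers the closed ball of radius `r`.
  refine ⟨T n, hTm n, hn, 1 / ((n : ℝ) + 2), by positivity, fun x hx r hr hrn => ?_⟩
  have hlim := tendsto_measure_biInter_gt (μ := σ₂) (s := fun r => Metric.closedBall x r) (a := r)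
    (fun _ _ => Metric.isClosed_closedBall.measurableSet.nullMeasurableSet)
    (fun i j _ hij => Metric.closedBall_subset_closedBall hij) ⟨r + 1, by simp, measure_ne_top _ _⟩
  rw [Metric.biInter_gt_closedBall] at hlim
  refine ge_of_tendsto hlim ?_
  have hlt : r < 1 / ((n : ℝ) + 1) := hrn.trans_lt (by gcongr; norm_num)
  filter_upwards [Ioo_mem_nhdsGT hlt] with r' hr'
  obtain ⟨q, hq1, hq2⟩ := exists_rat_btwn hr'.1
  calc _ ≤ σ₁ (Metric.closedBall x q) + ENNReal.ofReal (K * (q : ℝ) ^ d) := by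
        gcongr
    _ ≤ σ₂ (Metric.closedBall x q) :=
        Set.mem_iInter.1 hx.2 q (hr.trans hq1) (hq2.le.trans hr'.2.le)
    _ ≤ _ := measure_mono (Metric.closedBall_subset_closedBall hq2.le)

theorem eventually_mul_pow_le (K : ℝ) {C δ : ℝ} (hC : 0 < C) (hδ : 0 < δ) :
    ∀ᶠ r in 𝓝[>] (0 : ℝ), K * r ^ d ≤ C * ((r / 2) ^ d * r ^ (-δ)) := by
  have h := tendsto_rpow_neg_nhdsGT_zero (neg_neg_of_pos hδ)
  filter_upwards [h.eventually (eventually_ge_atTop (K * 2 ^ d / C)), self_mem_nhdsWithin]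
    with r hr hr0
  have hr0 : 0 < r := hr0
  rw [div_le_iff₀ hC] at hr
  calc K * r ^ d = (K * 2 ^ d) * (r / 2) ^ d := by rw [div_pow]; field_simp
    _ ≤ (r ^ (-δ) * C) * (r / 2) ^ d := by gcongr
    _ = _ := by ring

/-- The exceptional null set depends on the radius, so only rational radii are used. For real `r`,
pick a rational `q` in `(r / 2, r)`: then `q ^ d ≥ (r / 2) ^ d` and `q ^ (-δ) ≥ r ^ (-δ)`, and the
last factor blows up. -/
theorem ae_eventually_closedBall_of_uniform {σ : Measure (EuclideanSpace ℝ (Fin d))}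
    {S : Set (EuclideanSpace ℝ (Fin d))} {C δ r₀ : ℝ} (hC : 0 < C) (hδ : 0 < δ) (hr₀ : 0 < r₀)
    (h : ∀ r : ℝ, 0 < r → r ≤ r₀ → ∀ᵐ x ∂σ.restrict S,
      ENNReal.ofReal (C * r ^ ((d : ℝ) - δ)) ≤ σ (Metric.ball x r)) (K : ℝ) :
    ∀ᵐ x ∂σ.restrict S, ∀ᶠ r in 𝓝[>] (0 : ℝ),
      ENNReal.ofReal (K * r ^ d) ≤ σ (Metric.closedBall x r) := by
  have h' : ∀ᵐ x ∂σ.restrict S, ∀ q : ℚ, 0 < (q : ℝ) → (q : ℝ) ≤ r₀ →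
      ENNReal.ofReal (C * (q : ℝ) ^ ((d : ℝ) - δ)) ≤ σ (Metric.ball x q) :=
    ae_all_iff.2 fun q => by
      by_cases hq : 0 < (q : ℝ) ∧ (q : ℝ) ≤ r₀
      · filter_upwards [h q hq.1 hq.2] with x hx _ _ using hx
      · exact ae_of_all _ fun x h1 h2 => absurd ⟨h1, h2⟩ hq
  filter_upwards [h'] with x hx
  filter_upwards [eventually_mul_pow_le K hC hδ, Ioc_mem_nhdsGT hr₀] with r hr hr0
  obtain ⟨q, hq1, hq2⟩ := exists_rat_btwn (half_lt_self hr0.1)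
  have hr2 : 0 < r / 2 := half_pos hr0.1
  have hq0 : 0 < (q : ℝ) := hr2.trans hq1
  calc ENNReal.ofReal (K * r ^ d) ≤ ENNReal.ofReal (C * (q : ℝ) ^ ((d : ℝ) - δ)) := by
        refine ENNReal.ofReal_le_ofReal (hr.trans ?_)
        rw [sub_eq_add_neg, Real.rpow_add hq0, Real.rpow_natCast]
        have := Real.rpow_le_rpow_of_nonpos hq0 hq2.le (neg_nonpos.2 hδ.le)
        have := Real.rpow_nonneg hr0.1.le (-δ)
        gcongr
    _ ≤ σ (Metric.ball x q) := hx q hq0 (hq2.le.trans hr0.2)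
    _ ≤ _ := measure_mono ((Metric.ball_subset_ball hq2.le).trans Metric.ball_subset_closedBall)

theorem ofReal_rpow_le_of_log_div_lt {m : ℝ≥0∞} {r p : ℝ} (hr : 0 < r) (hr1 : r < 1)
    (h : ENNReal.log m / (Real.log r : EReal) < (p : EReal)) : ENNReal.ofReal (r ^ p) ≤ m := by
  have hlog : Real.log r < 0 := Real.log_neg hr hr1
  rcases eq_or_ne m ⊤ with rfl | hm
  · exact le_top
  rcases eq_or_ne m 0 with rfl | hm0
  -- For zero mass the quotient is `⊥` over a negative number, that is `⊤`, which the hypothesis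
  -- excludes.
  · rw [ENNReal.log_zero, EReal.bot_div_of_neg_ne_bot (by exact_mod_cast hlog)
      (EReal.coe_ne_bot _)] at h
    exact absurd h not_top_lt
  · have hpos := ENNReal.toReal_pos hm0 hm
    rw [← ENNReal.ofReal_toReal hm, ENNReal.log_ofReal_of_pos hpos, ← EReal.coe_div,
      EReal.coe_lt_coe_iff, div_lt_iff_of_neg hlog] at h
    refine ENNReal.ofReal_le_of_le_toReal ?_
    rw [← Real.log_le_log_iff (by positivity) hpos, Real.log_rpow hr]
    exact h.le

/-- The strict inequality between the dimension and `d - δ` gives, at small radii, mass at least `r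
^ (d - δ)`, which eventually exceeds `K r ^ d`. -/
theorem ae_eventually_closedBall_of_localDimension {σ : Measure (EuclideanSpace ℝ (Fin d))}
    {S : Set (EuclideanSpace ℝ (Fin d))} {δ : ℝ} (hδ : 0 < δ)
    (h : ∀ᵐ x ∂σ.restrict S, ∃ l : ℝ, HasLocalDimension (σ.restrict S) x l ∧ l < (d : ℝ) - δ)
    (K : ℝ) :
    ∀ᵐ x ∂σ.restrict S, ∀ᶠ r in 𝓝[>] (0 : ℝ),
      ENNReal.ofReal (K * r ^ d) ≤ σ (Metric.closedBall x r) := by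
  filter_upwards [h] with x ⟨l, hl, hlt⟩
  have hlt' : (l : EReal) < (((d : ℝ) - δ : ℝ) : EReal) := by exact_mod_cast hlt
  filter_upwards [eventually_mul_pow_le K one_pos hδ, hl.eventually (gt_mem_nhds hlt'),
    Ioo_mem_nhdsGT one_pos] with r hr hr' hr0
  have hr0' : 0 < r := hr0.1
  calc ENNReal.ofReal (K * r ^ d) ≤ ENNReal.ofReal (r ^ ((d : ℝ) - δ)) := by
        refine ENNReal.ofReal_le_ofReal (hr.trans ?_)
        rw [sub_eq_add_neg, Real.rpow_add hr0', Real.rpow_natCast, one_mul]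
        gcongr
        linarith
    _ ≤ σ.restrict S (Metric.ball x r) := ofReal_rpow_le_of_log_div_lt hr0.1 hr0.2 hr'
    _ ≤ σ (Metric.ball x r) := Measure.restrict_apply_le _ _
    _ ≤ _ := measure_mono Metric.ball_subset_closedBall

end Density

/-! ### First variation under partial smearing, and the contradiction -/

section Perturbation

variable {d : ℕ}

theorem kernelInt_add_right {k : EuclideanSpace ℝ (Fin d) → ℝ≥0∞} (hk : Measurable k)
    {α β σ : Measure (EuclideanSpace ℝ (Fin d))} [SFinite β] :
    kernelInt k σ (α + β) = kernelInt k σ α + kernelInt k σ β := by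
  unfold kernelInt
  simp_rw [lintegral_add_measure]
  exact lintegral_add_right _ (measurable_lintegral_sub hk)

/-- The second moment of the Gaussian measure. -/
def gaussMoment (d : ℕ) : ℝ≥0∞ :=
  ∫⁻ z : EuclideanSpace ℝ (Fin d), ENNReal.ofReal (‖z‖ ^ 2) ∂gaussMeasure d

/-- Use the plan that leaves `κ + a • α` in place and moves the remaining `b • α` by independent
displacements `√s • z`. -/
theorem sqWasserstein_le_of_smear {s : ℝ} (hs : 0 ≤ s) {a b : ℝ≥0∞} (hab : a + b = 1)
    (κ α : Measure (EuclideanSpace ℝ (Fin d))) [IsFiniteMeasure α] :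
    sqWasserstein (κ + α) (κ + a • α + b • smear s α) ≤
      b * (ENNReal.ofReal s * gaussMoment d * α Set.univ) := by
  have hdiag : Measurable fun x : EuclideanSpace ℝ (Fin d) => (x, x) := by fun_prop
  have hshift : Measurable fun p : EuclideanSpace ℝ (Fin d) × EuclideanSpace ℝ (Fin d) =>
      (p.1, p.1 + √s • p.2) := by fun_prop
  set γ : Measure (EuclideanSpace ℝ (Fin d) × EuclideanSpace ℝ (Fin d)) :=
    (κ + a • α).map (fun x => (x, x)) +
      b • (α.prod (gaussMeasure d)).map (fun p => (p.1, p.1 + √s • p.2)) with hγ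
  have h1 : γ.map Prod.fst = κ + α := by
    rw [hγ, Measure.map_add _ _ measurable_fst, Measure.map_map measurable_fst hdiag,
      Measure.map_smul, Measure.map_map measurable_fst hshift]
    have e1 : (Prod.fst ∘ fun x : EuclideanSpace ℝ (Fin d) => (x, x)) = id := rfl
    have e2 : (Prod.fst ∘ fun p : EuclideanSpace ℝ (Fin d) × EuclideanSpace ℝ (Fin d) =>
      (p.1, p.1 + √s • p.2)) = Prod.fst := rfl
    rw [e1, e2, Measure.map_id, Measure.map_fst_prod, measure_univ, one_smul, add_assoc,
      ← add_smul, hab, one_smul]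
  have h2 : γ.map Prod.snd = κ + a • α + b • smear s α := by
    rw [hγ, Measure.map_add _ _ measurable_snd, Measure.map_map measurable_snd hdiag,
      Measure.map_smul, Measure.map_map measurable_snd hshift]
    have e1 : (Prod.snd ∘ fun x : EuclideanSpace ℝ (Fin d) => (x, x)) = id := rfl
    rw [e1, Measure.map_id]
    rfl
  refine (iInf₂_le γ ⟨h1, h2⟩).trans_eq ?_
  have hm : Measurable fun p : EuclideanSpace ℝ (Fin d) × EuclideanSpace ℝ (Fin d) =>
      edist p.1 p.2 ^ 2 := by fun_prop
  rw [hγ, lintegral_add_measure, lintegral_smul_measure, lintegral_map hm hdiag,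
    lintegral_map hm hshift, lintegral_prod _ (by fun_prop)]
  have h3 : ∀ x z : EuclideanSpace ℝ (Fin d), edist x (x + √s • z) ^ 2 =
      ENNReal.ofReal s * ENNReal.ofReal (‖z‖ ^ 2) := by
    intro x z
    rw [edist_dist, dist_self_add_right, norm_smul, ← ENNReal.ofReal_pow (by positivity), mul_pow,
      Real.norm_eq_abs, sq_abs, Real.sq_sqrt hs, ENNReal.ofReal_mul hs]
  simp_rw [h3]
  simp only [edist_self, ne_eq, OfNat.ofNat_ne_zero, not_false_eq_true, zero_pow, lintegral_zero,
    zero_add, smul_eq_mul]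
  rw [lintegral_const_mul _ (by fun_prop), lintegral_const]
  rfl

/-- Compare `μ` with the competitor in which a fraction `ε` of `α` is smeared. The energy is
quadratic in `ε`, its linear coefficient is minus the left-hand side, and the transport term is at
most linear. Divide by `ε` and let it tend to 0. -/
theorem IsCoulombShift.first_variation {C : ℝ} (hd : 1 ≤ d) (hC : IsCoulombShift d C)
    {μ ν : ProbabilityMeasure (EuclideanSpace ℝ (Fin d))}
    (hμ : FiniteHeat (μ : Measure (EuclideanSpace ℝ (Fin d))))
    (hν : FiniteHeat (ν : Measure (EuclideanSpace ℝ (Fin d))))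
    {α : Measure (EuclideanSpace ℝ (Fin d))} (hα : α ≤ μ) {s τ : ℝ} (hs : 0 < s) (hτ : 0 < τ)
    (hmin : IsMinOn (fun ρ : ProbabilityMeasure (EuclideanSpace ℝ (Fin d)) =>
        mmdEnergy (coulombKernel d) ν ρ +
          ((sqWasserstein (μ : Measure (EuclideanSpace ℝ (Fin d))) (ρ : Measure _) /
            ENNReal.ofReal (2 * τ) : ℝ≥0∞) : EReal)) Set.univ μ) :
    coulombConst d * ((kernelInt (heatInt (Set.Ioc 0 s)) α μ).toReal -
        (kernelInt (heatInt (Set.Ioc 0 s)) α ν).toReal) ≤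
      s * (gaussMoment d).toReal * (α Set.univ).toReal / (2 * τ) := by
  have hαf := hμ.mono hα
  have := hαf.finite
  have hβf := hαf.smear hd hs
  set κ : Measure (EuclideanSpace ℝ (Fin d)) := (μ : Measure (EuclideanSpace ℝ (Fin d))) - α
    with hκ
  have hκα : κ + α = μ := Measure.sub_add_cancel_of_le hα
  have hκf : FiniteHeat κ := hμ.mono Measure.sub_le
  have := hκf.finite
  have hμf := hμ.finite
  have hνf := hν.finite
  set β := smear s α with hβ
  set w := s * (gaussMoment d).toReal * (α Set.univ).toReal / (2 * τ) with hw
  set D := coulombConst d * ((kernelInt (heatInt (Set.Ioc 0 s)) α μ).toReal -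
        (kernelInt (heatInt (Set.Ioc 0 s)) α ν).toReal) with hD
  set Q := heatEnergy C β β - 2 * heatEnergy C α β + heatEnergy C α α with hQ
  have key : ∀ ε : ℝ, 0 < ε → ε ≤ 1 → D ≤ ε * Q / 2 + w := by
    intro ε hε hε1
    set a := ENNReal.ofReal (1 - ε) with ha
    set b := ENNReal.ofReal ε with hb
    have hab : a + b = 1 := by
      rw [ha, hb, ← ENNReal.ofReal_add (by linarith) hε.le]; simp
    have har : a.toReal = 1 - ε := ENNReal.toReal_ofReal (by linarith)
    have hbr : b.toReal = ε := ENNReal.toReal_ofReal hε.le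
    have ha1 : a ≤ 1 := hab ▸ le_self_add
    have hb1 : b ≤ 1 := hab ▸ le_add_self
    have haf := hαf.smul ha1
    have hbf := hβf.smul hb1
    have hρf := (hκf.add haf).add hbf
    have hprob : IsProbabilityMeasure (κ + a • α + b • β) := by
      constructor
      simp only [Measure.add_apply, Measure.smul_apply, smul_eq_mul, hβ, smear_univ]
      rw [add_assoc, ← add_mul, hab, one_mul, ← Measure.add_apply, hκα]
      exact measure_univ
    set ρ : ProbabilityMeasure (EuclideanSpace ℝ (Fin d)) := ⟨κ + a • α + b • β, hprob⟩ with hρ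
    have hρc : (ρ : Measure (EuclideanSpace ℝ (Fin d))) = κ + a • α + b • β := rfl
    have hρf' : FiniteHeat (ρ : Measure (EuclideanSpace ℝ (Fin d))) := hρf
    have h1 := hmin (Set.mem_univ ρ)
    simp only [Set.mem_ofPred_eq] at h1
    rw [mmdEnergy_eq hd hC hμ hν, mmdEnergy_eq hd hC hρf' hν] at h1
    have hW : sqWasserstein (μ : Measure (EuclideanSpace ℝ (Fin d))) (ρ : Measure _) /
        ENNReal.ofReal (2 * τ) ≤ ENNReal.ofReal (ε * w) := by
      have h2 := sqWasserstein_le_of_smear hs.le hab κ α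
      rw [hκα] at h2
      calc _ ≤ b * (ENNReal.ofReal s * gaussMoment d * α Set.univ) / ENNReal.ofReal (2 * τ) := by
            gcongr
            exact h2
        _ = _ := by
            have hgm : gaussMoment d ≠ ⊤ := lintegral_gaussMeasure_sq_norm_lt_top.ne
            rw [← ENNReal.ofReal_toReal hgm, ← ENNReal.ofReal_toReal (measure_ne_top α Set.univ),
              ← ENNReal.ofReal_mul hs.le, ← ENNReal.ofReal_mul (by positivity),
              ← ENNReal.ofReal_mul hε.le, ← ENNReal.ofReal_div_of_pos (by positivity), hw,
              mul_div_assoc]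
    have hw0 : 0 ≤ w := by positivity
    have h3 : heatEnergy C (μ : Measure (EuclideanSpace ℝ (Fin d))) μ / 2
        - heatEnergy C (μ : Measure (EuclideanSpace ℝ (Fin d))) ν
        + heatEnergy C (ν : Measure (EuclideanSpace ℝ (Fin d))) ν / 2 ≤
        heatEnergy C (ρ : Measure (EuclideanSpace ℝ (Fin d))) ρ / 2
        - heatEnergy C (ρ : Measure (EuclideanSpace ℝ (Fin d))) ν
        + heatEnergy C (ν : Measure (EuclideanSpace ℝ (Fin d))) ν / 2 + ε * w := by
      rw [← EReal.coe_le_coe_iff, EReal.coe_add _ (ε * w)]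
      refine (le_add_of_nonneg_right ?_).trans (h1.trans ?_)
      · exact EReal.coe_ennreal_nonneg _
      · gcongr
        refine (EReal.coe_ennreal_le_coe_ennreal_iff.2 hW).trans_eq ?_
        rw [EReal.coe_ennreal_ofReal, max_eq_left (by positivity)]
    obtain ⟨_, hβμ⟩ := hαf.heatEnergy_smear_left hd C hs hμ
    obtain ⟨_, hβν⟩ := hαf.heatEnergy_smear_left hd C hs hν
    simp only [measure_univ] at hβμ hβν
    have eμ : ∀ {σ : Measure (EuclideanSpace ℝ (Fin d))}, FiniteHeat σ →
        heatEnergy C σ μ = heatEnergy C σ κ + heatEnergy C σ α := fun hσ => by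
      rw [← hκα, hκf.heatEnergy_add_right C hαf hσ]
    have eμ' : ∀ {σ : Measure (EuclideanSpace ℝ (Fin d))}, FiniteHeat σ →
        heatEnergy C μ σ = heatEnergy C κ σ + heatEnergy C α σ := fun hσ => by
      rw [← hκα, hκf.heatEnergy_add_left C hαf hσ]
    have eρ' : ∀ {σ : Measure (EuclideanSpace ℝ (Fin d))}, FiniteHeat σ →
        heatEnergy C ρ σ = heatEnergy C κ σ + (1 - ε) * heatEnergy C α σ +
          ε * heatEnergy C β σ := fun hσ => by
      rw [hρc, (hκf.add haf).heatEnergy_add_left C hbf hσ, hκf.heatEnergy_add_left C haf hσ,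
        heatEnergy_smul_left, heatEnergy_smul_left, har, hbr]
    have eρ : ∀ {σ : Measure (EuclideanSpace ℝ (Fin d))} [IsFiniteMeasure σ], FiniteHeat σ →
        heatEnergy C σ ρ = heatEnergy C σ κ + (1 - ε) * heatEnergy C σ α +
          ε * heatEnergy C σ β := fun {σ} _ hσ => by
      rw [hρc, (hκf.add haf).heatEnergy_add_right C hbf hσ, hκf.heatEnergy_add_right C haf hσ,
        heatEnergy_smul_right, heatEnergy_smul_right, har, hbr]
    rw [eρ' hρf', eρ hκf, eρ hαf, eρ hβf, eρ' hν, eμ' hμ, eμ' hν, eμ hκf, eμ hαf] at h3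
    rw [eμ hβf, eμ hαf] at hβμ
    have c1 : heatEnergy C κ α = heatEnergy C α κ := heatEnergy_comm C
    have c2 : heatEnergy C κ β = heatEnergy C β κ := heatEnergy_comm C
    have c3 : heatEnergy C β α = heatEnergy C α β := heatEnergy_comm C
    rw [c1, c2, c3] at h3
    rw [c3] at hβμ
    -- The constants in `hβμ` and `hβν` agree because `μ` and `ν` both have mass 1, so they cancel
    -- in the difference.
    have h4 : ε * D ≤ ε * (ε * Q / 2 + w) := by
      rw [hD, hQ]
      nlinarith
    exact le_of_mul_le_mul_left h4 hε
  refine le_of_forall_pos_le_add fun η hη => ?_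
  have hQ1 : 0 < |Q| + 1 := by positivity
  have h5 := key (min 1 (η / (|Q| + 1))) (by positivity) (min_le_left _ _)
  have h6 : min 1 (η / (|Q| + 1)) * Q ≤ η := by
    calc min 1 (η / (|Q| + 1)) * Q ≤ min 1 (η / (|Q| + 1)) * (|Q| + 1) := by
          gcongr
          linarith [le_abs_self Q]
      _ ≤ η / (|Q| + 1) * (|Q| + 1) := by
          gcongr
          exact min_le_right _ _
      _ = η := by field_simp
  linarith

theorem diffPosPart_eq_sub (μ ν : ProbabilityMeasure (EuclideanSpace ℝ (Fin d))) :
    diffPosPart μ ν = (μ : Measure (EuclideanSpace ℝ (Fin d))) - ν := by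
  rw [diffPosPart, Measure.toJordanDecomposition_toSignedMeasure_sub]
  rfl

/-- A subtraction-free form of `μ - ν = μ₊ - ν₋`, since measure subtraction is truncated. -/
theorem add_sub_comm_measure (μ ν : Measure (EuclideanSpace ℝ (Fin d))) [IsFiniteMeasure μ]
    [IsFiniteMeasure ν] : μ + (ν - μ) = ν + (μ - ν) := by
  rw [← Measure.toSignedMeasure_eq_toSignedMeasure_iff, Measure.toSignedMeasure_add,
    Measure.toSignedMeasure_add]
  have h := Measure.sub_toSignedMeasure_eq_toSignedMeasure_sub (μ := μ) (ν := ν)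
  rw [sub_eq_sub_iff_add_eq_add] at h
  rw [h, add_comm]

/-- If the density of `μ₊` is infinite on a set charged by `μ₊`, then `μ` is not critical. -/
theorem not_isWassersteinCriticalPoint_of_density (hd : 1 ≤ d)
    {μ ν : ProbabilityMeasure (EuclideanSpace ℝ (Fin d))}
    (hν : HasFiniteEnergy (coulombKernel d) (ν : Measure (EuclideanSpace ℝ (Fin d))))
    {A : Set (EuclideanSpace ℝ (Fin d))} (hA : MeasurableSet A) (hA0 : 0 < diffPosPart μ ν A)
    (h : ∀ K : ℝ, ∀ᵐ x ∂(diffPosPart μ ν).restrict A, ∀ᶠ r in 𝓝[>] (0 : ℝ),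
      ENNReal.ofReal (K * r ^ d) ≤ diffPosPart μ ν (Metric.closedBall x r)) :
    ¬ IsWassersteinCriticalPoint (mmdEnergy (coulombKernel d) ν) μ := by
  rintro ⟨hfin, τ, hτ, hcrit⟩
  obtain ⟨C, hC⟩ := exists_coulombKernel_decomposition hd
  have hC : IsCoulombShift d C := hC
  have hνf := hC.finiteHeat hd hν
  have hμf : FiniteHeat (μ : Measure (EuclideanSpace ℝ (Fin d))) := by
    refine hC.finiteHeat hd ?_
    by_contra hn
    rw [mmdEnergy, if_neg hn] at hfin
    exact lt_irrefl _ hfin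
  rw [diffPosPart_eq_sub] at hA0 h
  set p : Measure (EuclideanSpace ℝ (Fin d)) := (μ : Measure (EuclideanSpace ℝ (Fin d))) - ν
    with hp
  set n : Measure (EuclideanSpace ℝ (Fin d)) := (ν : Measure (EuclideanSpace ℝ (Fin d))) - μ
    with hn
  have hn1 : n Set.univ ≤ 1 := by
    calc n Set.univ ≤ (ν : Measure (EuclideanSpace ℝ (Fin d))) Set.univ := Measure.sub_le _
      _ = 1 := measure_univ
  have hc := coulombConst_pos hd
  have hκ0 : 0 < (ballHeat d).toReal := ENNReal.toReal_pos ballHeat_pos.ne' ballHeat_lt_top.ne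
  set M := (gaussMoment d).toReal
  -- The first summand matches the transport cost. Of the extra 2, one unit pays for the Gaussian
  -- tail and the other makes the final inequality strict.
  set K := (M / (2 * τ * coulombConst d) + 2) / (ballHeat d).toReal with hKdef
  have hK : 0 ≤ K := by positivity
  obtain ⟨T, hT, hT0, r₁, hr₁, hTr⟩ := exists_set_closedBall_le
    (Measure.mutually_singular_measure_sub (μ := (ν : Measure (EuclideanSpace ℝ (Fin d))))
      (ν := μ)) hA hA0 hK (h (2 * K))
  -- Choose `s` so that every `t` in `(0, s]` has tail at most 1 and satisfies `t ≤ r₁ ^ 2`.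
  obtain ⟨s, hs0, hs⟩ := mem_nhdsGT_iff_exists_Ioc_subset.1 (Filter.inter_mem
    (eventually_heat_tail_le_one (d := d) hr₁) (Ioc_mem_nhdsGT (by positivity : 0 < r₁ ^ 2)))
  have hs0 : 0 < s := hs0
  set α := p.restrict T with hα
  have hαμ : α ≤ μ := Measure.restrict_le_self.trans Measure.sub_le
  have hαf := hμf.mono hαμ
  have := hαf.finite
  have hα0 : 0 < (α Set.univ).toReal :=
    ENNReal.toReal_pos (by simpa [hα] using hT0.ne') (measure_ne_top _ _)
  have hpn : kernelInt (heatInt (Set.Ioc 0 s)) α n +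
      ENNReal.ofReal s * (ENNReal.ofReal K * ballHeat d * α Set.univ) ≤
      kernelInt (heatInt (Set.Ioc 0 s)) α p + ENNReal.ofReal s * α Set.univ := by
    have e : ∀ c : ℝ≥0∞, ENNReal.ofReal s * c = ∫⁻ t in Set.Ioc 0 s, c := fun c => by
      simp [mul_comm]
    rw [kernelInt_heatInt, kernelInt_heatInt, e, e, ← lintegral_add_right _ measurable_const,
      ← lintegral_add_right _ measurable_const]
    refine setLIntegral_mono (measurable_kernelInt_heatKernel.add_const _) fun t ht => ?_
    have e' : ∀ c : ℝ≥0∞, c * α Set.univ = ∫⁻ x, c ∂α := fun c => by simp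
    nth_rewrite 2 [← one_mul (α Set.univ)]
    rw [e', e', kernelInt, kernelInt, ← lintegral_add_right _ measurable_const,
      ← lintegral_add_right _ measurable_const]
    refine lintegral_mono_ae ?_
    filter_upwards [ae_restrict_mem hT] with x hx
    refine (lintegral_heatKernel_add_le_of_ball hn1 hK hr₁ ht.1 (hs ht).2.2 (hTr x hx)).trans ?_
    gcongr
    rw [← ENNReal.ofReal_one]
    exact ENNReal.ofReal_le_ofReal (hs ht).1
  have hm := measurable_heatInt (d := d) (Set.Ioc 0 s)
  have hbal : kernelInt (heatInt (Set.Ioc 0 s)) α μ + kernelInt (heatInt (Set.Ioc 0 s)) α n =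
      kernelInt (heatInt (Set.Ioc 0 s)) α ν + kernelInt (heatInt (Set.Ioc 0 s)) α p := by
    rw [← kernelInt_add_right hm, ← kernelInt_add_right hm, hn, hp, add_sub_comm_measure]
  have hfv := hC.first_variation hd hμf hνf hαμ hs0 hτ (hcrit τ hτ le_rfl)
  have fμ := (hαf.heatEnergy_smear_left hd C hs0 hμf).1.ne
  have fν := (hαf.heatEnergy_smear_left hd C hs0 hνf).1.ne
  have fn := (hαf.heatEnergy_smear_left hd C hs0 (hνf.mono (β := n) Measure.sub_le)).1.ne
  have fp := (hαf.heatEnergy_smear_left hd C hs0 (hμf.mono (β := p) Measure.sub_le)).1.ne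
  have hbal' := congrArg ENNReal.toReal hbal
  rw [ENNReal.toReal_add fμ fn, ENNReal.toReal_add fν fp] at hbal'
  have hαt : α Set.univ ≠ ⊤ := measure_ne_top _ _
  have h1 : ENNReal.ofReal s * α Set.univ ≠ ⊤ := ENNReal.mul_ne_top ENNReal.ofReal_ne_top hαt
  have h2 : ENNReal.ofReal s * (ENNReal.ofReal K * ballHeat d * α Set.univ) ≠ ⊤ :=
    ENNReal.mul_ne_top ENNReal.ofReal_ne_top (ENNReal.mul_ne_top (ENNReal.mul_ne_top
      ENNReal.ofReal_ne_top ballHeat_lt_top.ne) hαt)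
  have hpn' := ENNReal.toReal_mono (ENNReal.add_ne_top.2 ⟨fp, h1⟩) hpn
  rw [ENNReal.toReal_add fn h2, ENNReal.toReal_add fp h1] at hpn'
  simp only [ENNReal.toReal_mul, ENNReal.toReal_ofReal hs0.le, ENNReal.toReal_ofReal hK] at hpn'
  have hKκ : K * (ballHeat d).toReal = M / (2 * τ * coulombConst d) + 2 := by
    rw [hKdef]; field_simp
  rw [hKκ] at hpn'
  have h3 : coulombConst d * (s * (M / (2 * τ * coulombConst d) + 1) * (α Set.univ).toReal) ≤
      s * M * (α Set.univ).toReal / (2 * τ) := by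
    refine le_trans ?_ hfv
    refine mul_le_mul_of_nonneg_left ?_ hc.le
    linarith
  have h4 : coulombConst d * (s * (M / (2 * τ * coulombConst d) + 1) * (α Set.univ).toReal) =
      s * M * (α Set.univ).toReal / (2 * τ) + coulombConst d * s * (α Set.univ).toReal := by
    field_simp
  have h5 : 0 < coulombConst d * s * (α Set.univ).toReal := by positivity
  linarith

end Perturbation

end

/-! ### Both growth hypotheses reduced to infinite density -/

theorem mainTheorem5 (d : ℕ) (hd : 1 ≤ d)
    (μ ν : ProbabilityMeasure (EuclideanSpace ℝ (Fin d)))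
    (hν : HasFiniteEnergy (coulombKernel d) (ν : Measure (EuclideanSpace ℝ (Fin d)))) :
    (∀ (A : Set (EuclideanSpace ℝ (Fin d))) (δ : ℝ),
      MeasurableSet A → 0 < diffPosPart μ ν A → 0 < δ → δ < 2 →
      (∃ C : ℝ, 0 < C ∧ ∃ r₀ : ℝ, 0 < r₀ ∧ ∀ r : ℝ, 0 < r → r ≤ r₀ →
        ∀ᵐ x ∂((diffPosPart μ ν).restrict A),
          ENNReal.ofReal (C * r ^ ((d : ℝ) - δ)) ≤ diffPosPart μ ν (Metric.ball x r)) →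
      ¬ IsWassersteinCriticalPoint (mmdEnergy (coulombKernel d) ν) μ) ∧
    (∀ (A : Set (EuclideanSpace ℝ (Fin d))) (δ : ℝ),
      MeasurableSet A → 0 < diffPosPart μ ν A → 0 < δ → δ ≤ 1 →
      (∀ᵐ x ∂((diffPosPart μ ν).restrict A),
        ∃ l : ℝ, HasLocalDimension ((diffPosPart μ ν).restrict A) x l ∧ l < (d : ℝ) - δ) →
      ¬ IsWassersteinCriticalPoint (mmdEnergy (coulombKernel d) ν) μ) := by
  refine ⟨fun A δ hA hA0 hδ _ ⟨C, hC, r₀, hr₀, h⟩ => ?_, fun A δ hA hA0 hδ _ h => ?_⟩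
  · exact not_isWassersteinCriticalPoint_of_density hd hν hA hA0
      (ae_eventually_closedBall_of_uniform hC hδ hr₀ h)
  · exact not_isWassersteinCriticalPoint_of_density hd hν hA hA0
      (ae_eventually_closedBall_of_localDimension hδ h)
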